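/- **Setting.** Let $H,U_1,U_2,W$ be real Hilbert spaces, $A:\mathcal D(A)\subset H\to H$ a positive self-adjoint operator with compact inverse, and $V=\mathcal D(A^{1/2})$ with $\|v\|_V=\|A^{1/2}v\|_H$ and dual $V'$, so that $V\subset H\subset V'$. Let $j_U:V\to U_1$ and $j_W:H\to W$ be bounded linear maps (not necessarily injective); write $\|v\|_{U_1}=\|j_Uv\|_{U_1}$ for $v\in V$ and $\|v\|_W=\|j_Wv\|_W$ for $v\in H$. Let $\tau>0$, $0=t_0<t_1<t_2<\cdots$, $I_n=[t_n,t_{n+1})$, $T_n=t_{n+1}-t_n$, and assume $$T_{2n}\ge\tau,\qquad T_{2n+1}\le\tau\qquad\text{for all } n\in\mathbb N .$$ Let $B_1(t)\in\mathcal L(U_1,V')$ and $B_2(t)\in\mathcal L(U_2,H)$, with adjoints $B_1^*(t):V\to U_1$ and $B_2^*(t):H\to U_2$ (the Hilbert spaces $U_1,U_2,H$ being identified with their duals), satisfy, for every $n\in\mathbb N$: * $B_2=0$ on $I_{2n}$ and $B_1=0$ on $I_{2n+1}$; on $I_{2n+1}$, $B_2$ is the restriction of an element of $C([t_{2n+1},t_{2n+2}];\mathcal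 L(U_2,H))$; * on $I_{2n}$, either $B_1$ is the restriction of an element of $C^1([t_{2n},t_{2n+1}];\mathcal L(U_1,H))$, or $B_1(t)=\sqrt{b(t)}\,C_n$ with $C_n\in\mathcal L(U_1,V')$, $b\in W^{2,\infty}(t_{2n},t_{2n+1})$ and $b>0$ on $I_{2n}$; * there are constants $0<m_{2n}\le M_{2n}$ and $M_{2n+1}>0$ such that (i) $m_{2n}\|v\|_{U_1}^2\le\|B_1^*(t)v\|_{U_1}^2\le M_{2n}\|v\|_{U_1}^2$ for all $t\in I_{2n}$, $v\in V$; (ii) $\|B_2^*(t)v\|_{U_2}^2\le M_{2n+1}\|v\|_W^2$ for all $t\in I_{2n+1}$, $v\in H$. **Weak solutions.** For $w\in C([a,c];V)\cap C^1([a,c];H)$ we say that $z\in L^2(a,c;U_1)$ is $B_1^*w_t$ on $(a,c)$ if $\int_a^{c-h}\big\|B_1^*(s)\tfrac{w(s+h)-w(s)}h-z(s)\big\|_{U_1}^2ds\to0$ as $h\downarrow0$. A *weak solution* $w$ of $$w_{tt}+Aw+B_1(t)B_1^*(t)w_t=0\quad\text{on } (t_{2n},t_{2n+1}) \tag{D$_n$}$$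 is a $w\in C([t_{2n},t_{2n+1}];V)\cap C^1([t_{2n},t_{2n+1}];H)$ such that $B_1^*w_t\in L^2(t_{2n},t_{2n+1};U_1)$ exists in this sense and, for all $\varphi\in V$ and $t\in[t_{2n},t_{2n+1}]$, $$(w_t(t),\varphi)_H-(w_t(t_{2n}),\varphi)_H+\int_{t_{2n}}^{t}\big[(w,\varphi)_V+(B_1^*w_t,B_1^*(s)\varphi)_{U_1}\big]ds=0 .$$ A *solution* $u$ of $$u_{tt}(t)+Au(t)+B_1(t)B_1^*(t)u_t(t)+B_2(t)B_2^*(t)u_t(t-\tau)=0,\quad t>0, \tag{P}$$ is a $u\in C([0,\infty);V)\cap C^1([0,\infty);H)$ such that $B_1^*u_t\in L^2(t_n,t_{n+1};U_1)$ exists on every $(t_n,t_{n+1})$ and, for all $\varphi\in V$ and $t\ge0$, $$(u_t(t),\varphi)_H-(u_t(0),\varphi)_H+\int_0^t\big[(u,\varphi)_V+(B_1^*u_t,B_1^*(s)\varphi)_{U_1}+(B_2(s)B_2^*(s)u_t(s-\tau),\varphi)_H\big]ds=0 ;$$ no values of $u_t$ at negative times are needed, because $B_2=0$ on $[0,t_1)$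 and $t_1\ge\tau$. The standard energy is $E_S(w,t)=\frac12\big(\|w(t)\|_V^2+\|w_t(t)\|_H^2\big)$. **Observability hypothesis.** For every $n$ there is $\overline T_n\ge0$ with $\overline T_n<T_{2n}$ such that for every $T\in(\overline T_n,T_{2n}]$ there is a constant $d_n(T)>0$ with $$E_S(w,t_{2n}+T)\le d_n(T)\int_{t_{2n}}^{t_{2n}+T}\|B_1^*w_t(t)\|_{U_1}^2\,dt$$ for every weak solution $w$ of (D$_n$), with arbitrary initial data in $V\times H$ at $t_{2n}$. Put $d_n=d_n(T_{2n})$. **Theorem.** If $$\sum_{n=0}^\infty M_{2n+1}T_{2n+1}<+\infty\qquad\text{and}\qquad\sum_{n=0}^\infty\ln\frac{d_n}{d_n+1}=-\infty,$$ then every solution $u$ of (P), with arbitrary initial data $(u(0),u_t(0))\in V\times H$, satisfies $E_S(u,t)\to0$ as $t\to+\infty$. -/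

import Mathlib

open Set Filter Topology MeasureTheory
open scoped ContDiff

/-- A (densely defined) positive self-adjoint operator on `H` which is onto, one-to-one and has a
compact bounded inverse. Density of the domain is part of `IsSelfAdjoint` for partial maps
(`IsSelfAdjoint.dense_domain`). -/
structure IsPosSelfAdjointCompactInverse {H : Type*} [NormedAddCommGroup H]
    [InnerProductSpace ℝ H] [CompleteSpace H] (A : H →ₗ.[ℝ] H) : Prop where
  selfAdjoint : IsSelfAdjoint A
  nonneg : ∀ x : A.domain, 0 ≤ inner ℝ (A x) (x : H)
  compact_inverse : ∃ G : H →L[ℝ] H, IsCompactOperator G ∧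
    (∀ y : H, ∃ h : G y ∈ A.domain, A ⟨G y, h⟩ = y) ∧ ∀ x : A.domain, G (A x) = x

/-- `S = A^{1/2}`: `S` is the positive self-adjoint operator with `S ∘ S = A`, where the domain of
`S ∘ S` is the set of `x ∈ D(S)` with `S x ∈ D(S)`. A positive self-adjoint operator has exactly
one such square root. -/
structure IsPosSqrt {H : Type*} [NormedAddCommGroup H]
    [InnerProductSpace ℝ H] [CompleteSpace H] (S A : H →ₗ.[ℝ] H) : Prop where
  selfAdjoint : IsSelfAdjoint S
  nonneg : ∀ x : S.domain, 0 ≤ inner ℝ (S x) (x : H)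
  mem_domain_iff : ∀ x : H, x ∈ A.domain ↔ ∃ hx : x ∈ S.domain, S ⟨x, hx⟩ ∈ S.domain
  sq_eq : ∀ (x : H) (hA : x ∈ A.domain) (hS : x ∈ S.domain) (hSS : S ⟨x, hS⟩ ∈ S.domain),
    S ⟨S ⟨x, hS⟩, hSS⟩ = A ⟨x, hA⟩

/-- For `S = A^{1/2}` this is the space `V = D(A^{1/2})`, with the inner product
`(u, v)_V = (A^{1/2} u, A^{1/2} v)_H` and the norm `‖u‖_V = ‖A^{1/2} u‖_H`
(not the topology inherited from `H`). -/
def EnergySpace {H : Type*} [NormedAddCommGroup H] [InnerProductSpace ℝ H]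
    (S : H →ₗ.[ℝ] H) : Type _ := S.domain

namespace EnergySpace

variable {H : Type*} [NormedAddCommGroup H] [InnerProductSpace ℝ H] (S : H →ₗ.[ℝ] H)

instance : AddCommGroup (EnergySpace S) := inferInstanceAs (AddCommGroup S.domain)

instance : Module ℝ (EnergySpace S) := inferInstanceAs (Module ℝ S.domain)

/-- The inclusion `V ⊆ H`. -/
def toH : EnergySpace S →ₗ[ℝ] H := S.domain.subtype

/-- The operator `S = A^{1/2}` on `V`. -/
def sqrtMap : EnergySpace S →ₗ[ℝ] H := S.toFun

noncomputable instance : SeminormedAddCommGroup (EnergySpace S) :=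
  SeminormedAddCommGroup.induced (EnergySpace S) H (sqrtMap S)

noncomputable instance : InnerProductSpace ℝ (EnergySpace S) where
  __ := NormedSpace.induced ℝ (EnergySpace S) H (sqrtMap S)
  inner u v := inner ℝ (sqrtMap S u) (sqrtMap S v)
  norm_sq_eq_re_inner u := norm_sq_eq_re_inner (𝕜 := ℝ) (sqrtMap S u)
  conj_inner_symm u v := inner_conj_symm (𝕜 := ℝ) (sqrtMap S u) (sqrtMap S v)
  add_left u v w := by
    show inner ℝ (sqrtMap S (u + v)) (sqrtMap S w) = _
    rw [map_add, inner_add_left]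
  smul_left u v r := by
    show inner ℝ (sqrtMap S (r • u)) (sqrtMap S v) = _
    rw [map_smul, inner_smul_left]

end EnergySpace

/-- The adjoint `B^* : V → U` of a bounded operator `B : U → V'`, where `U` is identified with its
dual: `(B^* v, x)_U = ⟨B x, v⟩_{V', V}`. -/
noncomputable def dualAdjoint {U V : Type*} [NormedAddCommGroup U] [InnerProductSpace ℝ U]
    [CompleteSpace U] [SeminormedAddCommGroup V] [NormedSpace ℝ V]
    (B : U →L[ℝ] StrongDual ℝ V) (v : V) : U :=
  (InnerProductSpace.toDual ℝ U).symm (B.flip v)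

theorem inner_dualAdjoint {U V : Type*} [NormedAddCommGroup U] [InnerProductSpace ℝ U]
    [CompleteSpace U] [SeminormedAddCommGroup V] [NormedSpace ℝ V]
    (B : U →L[ℝ] StrongDual ℝ V) (v : V) (x : U) : inner ℝ (dualAdjoint B v) x = B x v := by
  simp [dualAdjoint]

/-- `g` is the weak (distributional) derivative of `f` on the interval `(a, c)`. -/
def HasWeakDerivOn (a c : ℝ) (f g : ℝ → ℝ) : Prop :=
  ∀ ψ : ℝ → ℝ, ContDiff ℝ ∞ ψ → HasCompactSupport ψ → tsupport ψ ⊆ Ioo a c →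
    ∫ s in Ioo a c, f s * deriv ψ s = -∫ s in Ioo a c, g s * ψ s

/-- `f ∈ W^{2,∞}(a, c)`. -/
def MemW2Infty (a c : ℝ) (f : ℝ → ℝ) : Prop :=
  MemLp f ⊤ (volume.restrict (Ioo a c)) ∧ ∃ f' f'' : ℝ → ℝ,
    MemLp f' ⊤ (volume.restrict (Ioo a c)) ∧ MemLp f'' ⊤ (volume.restrict (Ioo a c)) ∧
    HasWeakDerivOn a c f f' ∧ HasWeakDerivOn a c f' f''

section Equation

variable {H : Type*} [NormedAddCommGroup H] [InnerProductSpace ℝ H] [CompleteSpace H]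
  {U₁ : Type*} [NormedAddCommGroup U₁] [InnerProductSpace ℝ U₁] [CompleteSpace U₁]
  {U₂ : Type*} [NormedAddCommGroup U₂] [InnerProductSpace ℝ U₂] [CompleteSpace U₂]
  {S : H →ₗ.[ℝ] H}

/-- Structural assumption on `B₁` on `[a, c)`: either `B₁` is (the restriction of) an element of
`C¹([a, c]; L(U₁, H))`, with `H ⊆ V'` through the inner product of `H`, or
`B₁(s) = √(b(s)) C` with `C ∈ L(U₁, V')`, `b ∈ W^{2,∞}(a, c)` and `b > 0` on `[a, c)`. -/
def AdmissibleDamping (B₁ : ℝ → U₁ →L[ℝ] StrongDual ℝ (EnergySpace S)) (a c : ℝ) : Prop :=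
  (∃ F : ℝ → U₁ →L[ℝ] H, ContDiffOn ℝ 1 F (Icc a c) ∧
    ∀ s ∈ Ico a c, ∀ (x : U₁) (φ : EnergySpace S),
      B₁ s x φ = inner ℝ (F s x) (EnergySpace.toH S φ)) ∨
  (∃ (b : ℝ → ℝ) (C : U₁ →L[ℝ] StrongDual ℝ (EnergySpace S)),
    MemW2Infty a c b ∧ (∀ s ∈ Ico a c, 0 < b s) ∧ ∀ s ∈ Ico a c, B₁ s = √(b s) • C)

/-- `z = B₁^* w_t` in `L²(a, c; U₁)` for `w ∈ C([a, c]; V)`. As `w_t(s)` lies only in `H`, while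
`B₁^*(s)` acts on `V`, the time derivative is taken in `L²`: `z` is the limit in `L²`, as `h ↓ 0`,
of the difference quotients `B₁^*(s) ((w(s + h) - w(s)) / h)`. -/
def HasVelocityTrace (B₁ : ℝ → U₁ →L[ℝ] StrongDual ℝ (EnergySpace S)) (a c : ℝ)
    (w : ℝ → EnergySpace S) (z : ℝ → U₁) : Prop :=
  MemLp z 2 (volume.restrict (Ioo a c)) ∧
  Tendsto (fun h : ℝ => ∫⁻ s in Ioo a (c - h),
    ‖dualAdjoint (B₁ s) (h⁻¹ • (w (s + h) - w s)) - z s‖ₑ ^ 2) (𝓝[>] 0) (𝓝 0)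

/-- Weak form of `w_tt + A w + B₁ z + f = 0` on the time interval `J` with left end point `a ∈ J`,
for `w ∈ C(J; V) ∩ C¹(J; H)` with `w_t = w'`, tested with all `φ ∈ V` and integrated in time from
`a`; here `⟨A w, φ⟩ = (w, φ)_V`. The initial data are `w a ∈ V` and `w' a ∈ H`. -/
structure IsWeakSolution (B₁ : ℝ → U₁ →L[ℝ] StrongDual ℝ (EnergySpace S)) (f : ℝ → H)
    (a : ℝ) (J : Set ℝ) (w : ℝ → EnergySpace S) (w' : ℝ → H) (z : ℝ → U₁) : Prop where
  continuousOn : ContinuousOn w J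
  continuousOn_deriv : ContinuousOn w' J
  hasDeriv : ∀ s ∈ J, HasDerivWithinAt (fun r => EnergySpace.toH S (w r)) (w' s) J s
  weak_eq : ∀ φ : EnergySpace S, ∀ s ∈ J,
    inner ℝ (w' s) (EnergySpace.toH S φ) - inner ℝ (w' a) (EnergySpace.toH S φ) +
      ∫ r in a..s, (inner ℝ (w r) φ + inner ℝ (z r) (dualAdjoint (B₁ r) φ) +
        inner ℝ (f r) (EnergySpace.toH S φ)) = 0

/-- Weak solution of the damped system without delay `w_tt + A w + B₁ B₁^* w_t = 0` on `[a, c]`,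
with `w' = w_t` and `z = B₁^* w_t`. -/
def IsDampedSolution (B₁ : ℝ → U₁ →L[ℝ] StrongDual ℝ (EnergySpace S)) (a c : ℝ)
    (w : ℝ → EnergySpace S) (w' : ℝ → H) (z : ℝ → U₁) : Prop :=
  HasVelocityTrace B₁ a c w z ∧ IsWeakSolution B₁ (fun _ => 0) a (Icc a c) w w' z

/-- Weak solution of `u_tt + A u + B₁ B₁^* u_t + B₂ B₂^* u_t(· - τ) = 0` on `[0, ∞)`, with
`u' = u_t`, where `z = B₁^* u_t` on each of the intervals `(t n, t (n + 1))`. -/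
def IsDelaySolution (B₁ : ℝ → U₁ →L[ℝ] StrongDual ℝ (EnergySpace S)) (B₂ : ℝ → U₂ →L[ℝ] H)
    (τ : ℝ) (t : ℕ → ℝ) (u : ℝ → EnergySpace S) (u' : ℝ → H) (z : ℝ → U₁) : Prop :=
  (∀ n, HasVelocityTrace B₁ (t n) (t (n + 1)) u z) ∧
  IsWeakSolution B₁ (fun s => B₂ s (ContinuousLinearMap.adjoint (B₂ s) (u' (s - τ)))) 0 (Ici 0)
    u u' z

/-- The standard energy `E_S = (‖u‖_V² + ‖u_t‖_H²) / 2`. -/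
noncomputable def standardEnergy (v : EnergySpace S) (v' : H) : ℝ :=
  (‖v‖ ^ 2 + ‖v'‖ ^ 2) / 2

end Equation

/-!
On a damped interval the weak equation involves `u_t` only as an element of `H`, so `u_t` is no
admissible test function. The energy identity is obtained by testing the equation, averaged over
`(s, s + h)`, with the difference quotient of `u`: this is exact for the energy of the difference
quotients, and as `h ↓ 0` the averages and the quotients `B₁^* (u(· + h) - u) / h` converge in
`L²`. Together with observability it gives `E(t_{2n+1}) ≤ d_n / (d_n + 1) E(t_{2n})`.

On a delayed interval the force at time `s` is controlled by the velocity at time `s - τ`, which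
lies in the preceding damped interval, where `E ≤ E(t_{2n})`. Hence `√E` grows there by at most
`ε_n √E(t_{2n})` with `ε_n` proportional to `M_{2n+1} T_{2n+1}`. So `x_n = √E(t_{2n})` satisfies
`x_{n+1} ≤ (q_n + ε_n) x_n` with `q_n = √(d_n / (d_n + 1))`, `∏ q_n = 0` and `∑ ε_n < ∞`: the
sequence is bounded since `q_n ≤ 1`, the perturbations `ε_n x_n` are therefore summable, and the
vanishing product forces `x_n → 0`.
-/

section LpAverages

theorem aestronglyMeasurable_uncurry_add {Y : Type*} [TopologicalSpace Y] {ν : Measure ℝ}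
    [SFinite ν] {G : ℝ → Y} (hG : AEStronglyMeasurable G volume) :
    AEStronglyMeasurable (fun x : ℝ × ℝ => G (x.1 + x.2)) (volume.prod ν) :=
  hG.comp_quasiMeasurePreserving <| QuasiMeasurePreserving.prod_of_left
    (measurable_fst.add measurable_snd)
    (Eventually.of_forall fun k => (measurePreserving_add_right volume k).quasiMeasurePreserving)

variable {X : Type*} [NormedAddCommGroup X]

theorem tendsto_eLpNorm_translation_sub {p : ENNReal} [Fact (1 ≤ p)] (hp : p ≠ ⊤) {G : ℝ → X}
    (hG : MemLp G p volume) :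
    Tendsto (fun k : ℝ => eLpNorm (fun s => G (s + k) - G s) p volume) (𝓝 0) (𝓝 0) := by
  have : Fact (p ≠ ⊤) := ⟨hp⟩
  have hcont : Continuous fun k : ℝ =>
      (DomAddAct.mk k +ᵥ hG.toLp G : Lp X p (volume : Measure ℝ)) :=
    DomAddAct.continuous_mk.vadd continuous_const
  have hlim := tendsto_iff_edist_tendsto_0.1 (hcont.tendsto 0)
  refine hlim.congr fun k => ?_
  rw [DomAddAct.mk_zero, zero_vadd, DomAddAct.mk_vadd_toLp, Lp.edist_toLp_toLp]
  refine eLpNorm_congr_ae (Eventually.of_forall fun s => ?_)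
  simp only [vadd_eq_add, add_comm k, Pi.sub_apply]

variable [NormedSpace ℝ X]

theorem enorm_integral_rpow_le_lintegral {α : Type*} [MeasurableSpace α] {ν : Measure α}
    [IsProbabilityMeasure ν] {p : NNReal} (hp : 1 ≤ p) {f : α → X}
    (hf : AEStronglyMeasurable f ν) :
    ‖∫ x, f x ∂ν‖ₑ ^ (p : ℝ) ≤ ∫⁻ x, ‖f x‖ₑ ^ (p : ℝ) ∂ν := by
  rw [← eLpNorm_nnreal_pow_eq_lintegral (zero_lt_one.trans_le hp).ne']
  gcongr
  calc ‖∫ x, f x ∂ν‖ₑ ≤ eLpNorm f 1 ν := by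
        rw [eLpNorm_one_eq_lintegral_enorm]
        exact enorm_integral_le_lintegral_enorm f
    _ ≤ eLpNorm f p ν := eLpNorm_le_eLpNorm_of_exponent_le (by exact_mod_cast hp) hf

theorem eLpNorm_integral_rpow_le_lintegral {α β : Type*} [MeasurableSpace α] [MeasurableSpace β]
    {μ : Measure α} [SFinite μ] {ν : Measure β} [IsProbabilityMeasure ν] {p : NNReal}
    (hp : 1 ≤ p) {f : α → β → X} (hf : AEStronglyMeasurable (Function.uncurry f) (μ.prod ν)) :
    eLpNorm (fun x => ∫ y, f x y ∂ν) p μ ^ (p : ℝ) ≤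
      ∫⁻ y, eLpNorm (fun x => f x y) p μ ^ (p : ℝ) ∂ν := by
  have hp0 : p ≠ 0 := (zero_lt_one.trans_le hp).ne'
  simp only [eLpNorm_nnreal_pow_eq_lintegral hp0]
  calc ∫⁻ x, ‖∫ y, f x y ∂ν‖ₑ ^ (p : ℝ) ∂μ ≤ ∫⁻ x, ∫⁻ y, ‖f x y‖ₑ ^ (p : ℝ) ∂ν ∂μ :=
        lintegral_mono_ae (hf.prodMk_left.mono fun _ hx => enorm_integral_rpow_le_lintegral hp hx)
    _ = ∫⁻ y, ∫⁻ x, ‖f x y‖ₑ ^ (p : ℝ) ∂μ ∂ν :=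
        lintegral_lintegral_swap (hf.enorm.pow_const _)

variable [CompleteSpace X]

theorem intervalAverage_sub_eq_average_translation_sub {G : ℝ → X} (hG : LocallyIntegrable G)
    {h : ℝ} (hh : 0 < h) (s : ℝ) :
    (⨍ r in s..s + h, G r) - G s = ⨍ k in Ioc 0 h, (G (s + k) - G s) := by
  have hint : IntervalIntegrable (fun k => G (s + k)) volume 0 h := by
    simpa using ((hG.integrableOn_isCompact isCompact_uIcc).intervalIntegrable
      (a := s) (b := s + h)).comp_add_left s
  rw [← uIoc_of_le hh.le, interval_average_eq, interval_average_eq,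
    intervalIntegral.integral_sub hint (by simp), intervalIntegral.integral_comp_add_left G s,
    intervalIntegral.integral_const, smul_sub, smul_smul]
  simp [hh.ne']

theorem eLpNorm_intervalAverage_sub_le {p : NNReal} (hp : 1 ≤ p) {G : ℝ → X}
    (hG : MemLp G p volume) {h : ℝ} (hh : 0 < h) {ε : ENNReal}
    (hε : ∀ k ∈ Ioc 0 h, eLpNorm (fun s => G (s + k) - G s) p volume ≤ ε) :
    eLpNorm (fun s => (⨍ r in s..s + h, G r) - G s) p volume ≤ ε := by
  have hp0 : (0 : ℝ) < p := zero_lt_one.trans_le (by exact_mod_cast hp)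
  have : NeZero (volume.restrict (Ioc 0 h)) := ⟨by simp [Measure.restrict_eq_zero, hh]⟩
  set ν : Measure ℝ := (volume.restrict (Ioc 0 h) univ)⁻¹ • volume.restrict (Ioc 0 h)
  have hν : ∀ᵐ k ∂ν, k ∈ Ioc 0 h :=
    Measure.smul_absolutelyContinuous.ae_le (ae_restrict_mem measurableSet_Ioc)
  have hmeas : AEStronglyMeasurable (Function.uncurry fun s k => G (s + k) - G s)
      (volume.prod ν) :=
    (aestronglyMeasurable_uncurry_add hG.1).sub
      (hG.1.comp_quasiMeasurePreserving Measure.quasiMeasurePreserving_fst)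
  rw [← ENNReal.rpow_le_rpow_iff hp0]
  calc eLpNorm (fun s => (⨍ r in s..s + h, G r) - G s) p volume ^ (p : ℝ)
      = eLpNorm (fun s => ∫ k, (G (s + k) - G s) ∂ν) p volume ^ (p : ℝ) := by
        simp only [intervalAverage_sub_eq_average_translation_sub
          (hG.locallyIntegrable (by exact_mod_cast hp)) hh]
        rfl
    _ ≤ ∫⁻ k, eLpNorm (fun s => G (s + k) - G s) p volume ^ (p : ℝ) ∂ν :=
        eLpNorm_integral_rpow_le_lintegral hp hmeas
    _ ≤ ∫⁻ _, ε ^ (p : ℝ) ∂ν :=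
        lintegral_mono_ae (hν.mono fun k hk => ENNReal.rpow_le_rpow (hε k hk) hp0.le)
    _ = ε ^ (p : ℝ) := by rw [lintegral_const, measure_univ, mul_one]

theorem tendsto_eLpNorm_intervalAverage_sub {p : NNReal} (hp : 1 ≤ p) {G : ℝ → X}
    (hG : MemLp G p volume) :
    Tendsto (fun h : ℝ => eLpNorm (fun s => (⨍ r in s..s + h, G r) - G s) p volume)
      (𝓝[>] 0) (𝓝 0) := by
  have : Fact (1 ≤ (p : ENNReal)) := ⟨by exact_mod_cast hp⟩
  refine ENNReal.tendsto_nhds_zero.2 fun ε hε => ?_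
  obtain ⟨δ, hδ, hball⟩ := Metric.eventually_nhds_iff.1
    (ENNReal.tendsto_nhds_zero.1 (tendsto_eLpNorm_translation_sub ENNReal.coe_ne_top hG) ε hε)
  filter_upwards [Ioo_mem_nhdsGT hδ] with h hh
  refine eLpNorm_intervalAverage_sub_le hp hG hh.1 fun k hk => hball ?_
  rw [Real.dist_0_eq_abs, abs_of_pos hk.1]
  exact hk.2.trans_lt hh.2

end LpAverages

section L2Convergence

variable {α ι E : Type*} [MeasurableSpace α] {μ : Measure α} {l : Filter ι}

theorem eventually_memLp_of_tendsto_eLpNorm_sub [NormedAddCommGroup E] {p : ENNReal}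
    {F : ι → α → E} {f : α → E} (hF : ∀ᶠ i in l, AEStronglyMeasurable (F i) μ) (hf : MemLp f p μ)
    (hFf : Tendsto (fun i => eLpNorm (F i - f) p μ) l (𝓝 0)) :
    ∀ᶠ i in l, MemLp (F i) p μ := by
  filter_upwards [hF, hFf.eventually (gt_mem_nhds ENNReal.zero_lt_top)] with i hi hfin
  have hsub : MemLp (F i - f) p μ := ⟨hi.sub hf.1, hfin⟩
  simpa only [sub_add_cancel] using hsub.add hf

theorem tendsto_integral_inner_of_tendsto_eLpNorm_sub [NormedAddCommGroup E]
    [InnerProductSpace ℝ E] {F Y : ι → α → E} {f y : α → E}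
    (hF : ∀ᶠ i in l, AEStronglyMeasurable (F i) μ) (hf : MemLp f 2 μ)
    (hY : ∀ᶠ i in l, AEStronglyMeasurable (Y i) μ) (hy : MemLp y 2 μ)
    (hFf : Tendsto (fun i => eLpNorm (F i - f) 2 μ) l (𝓝 0))
    (hYy : Tendsto (fun i => eLpNorm (Y i - y) 2 μ) l (𝓝 0)) :
    Tendsto (fun i => ∫ x, inner ℝ (F i x) (Y i x) ∂μ) l (𝓝 (∫ x, inner ℝ (f x) (y x) ∂μ)) := by
  classical
  have lift : ∀ {F : ι → α → E} {f : α → E} (hf : MemLp f 2 μ), (∀ᶠ i in l, MemLp (F i) 2 μ) →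
      Tendsto (fun i => eLpNorm (F i - f) 2 μ) l (𝓝 0) →
      Tendsto (fun i => if h : MemLp (F i) 2 μ then h.toLp (F i) else 0) l
        (𝓝 (hf.toLp f)) := by
    intro F f hf hmem hFf
    rw [tendsto_iff_edist_tendsto_0]
    refine hFf.congr' (hmem.mono fun i hi => ?_)
    simp only [dif_pos hi, Lp.edist_toLp_toLp]
  have inner_toLp : ∀ {f y : α → E} (hf : MemLp f 2 μ) (hy : MemLp y 2 μ),
      inner ℝ (hf.toLp f) (hy.toLp y) = ∫ x, inner ℝ (f x) (y x) ∂μ := by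
    intro f y hf hy
    rw [L2.inner_def]
    refine integral_congr_ae ?_
    filter_upwards [hf.coeFn_toLp, hy.coeFn_toLp] with x hfx hyx
    rw [hfx, hyx]
  have hFmem := eventually_memLp_of_tendsto_eLpNorm_sub hF hf hFf
  have hYmem := eventually_memLp_of_tendsto_eLpNorm_sub hY hy hYy
  have hlim := (lift hf hFmem hFf).inner (𝕜 := ℝ) (lift hy hYmem hYy)
  rw [inner_toLp] at hlim
  refine hlim.congr' ?_
  filter_upwards [hFmem, hYmem] with i hFi hYi
  rw [dif_pos hFi, dif_pos hYi, inner_toLp]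

theorem tendsto_lintegral_enorm_sq_iff_tendsto_eLpNorm [NormedAddCommGroup E] {F : ι → α → E}
    {μ : ι → Measure α} :
    Tendsto (fun i => ∫⁻ x, ‖F i x‖ₑ ^ 2 ∂μ i) l (𝓝 0) ↔
      Tendsto (fun i => eLpNorm (F i) 2 (μ i)) l (𝓝 0) := by
  have hsq : ∀ i, ∫⁻ x, ‖F i x‖ₑ ^ 2 ∂μ i = eLpNorm (F i) 2 (μ i) ^ 2 := fun i => by
    simpa using (eLpNorm_nnreal_pow_eq_lintegral (μ := μ i) (f := F i) (p := 2) two_ne_zero).symm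
  simp only [hsq]
  refine ⟨fun h => ?_, fun h => ?_⟩
  · have hsqrt := (ENNReal.continuous_rpow_const (y := (2 : ℝ)⁻¹)).tendsto' 0 0 (by norm_num)
    refine (hsqrt.comp h).congr fun i => ?_
    rw [Function.comp_apply, ← ENNReal.rpow_natCast, ← ENNReal.rpow_mul]
    norm_num
  · simpa using ENNReal.Tendsto.pow (n := 2) h

end L2Convergence

section DifferenceQuotients

/-- The forward difference quotient of `f` with step `h`. -/
noncomputable def diffQuot {E : Type*} [AddCommGroup E] [Module ℝ E] (h : ℝ) (f : ℝ → E) (s : ℝ) :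
    E :=
  h⁻¹ • (f (s + h) - f s)

theorem map_diffQuot {E F : Type*} [AddCommGroup E] [Module ℝ E] [AddCommGroup F] [Module ℝ F]
    (L : E →ₗ[ℝ] F) (h : ℝ) (f : ℝ → E) (s : ℝ) :
    L (diffQuot h f s) = diffQuot h (fun r => L (f r)) s := by
  simp only [diffQuot, map_smul, map_sub]

variable {E : Type*} [NormedAddCommGroup E] [NormedSpace ℝ E] {a c h : ℝ}

theorem continuousOn_diffQuot {f : ℝ → E} (hf : ContinuousOn f (Icc a c)) (hh : 0 ≤ h) :
    ContinuousOn (diffQuot h f) (Icc a (c - h)) := by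
  refine ((hf.comp (by fun_prop) fun s hs => ?_).sub
    (hf.mono (Icc_subset_Icc_right (by linarith)))).const_smul _
  exact ⟨by linarith [hs.1], by linarith [hs.2]⟩

theorem tendsto_diffQuot_left {f : ℝ → E} {v : E} (hac : a < c)
    (hf : HasDerivWithinAt f v (Icc a c) a) :
    Tendsto (fun h => diffQuot h f a) (𝓝[>] 0) (𝓝 v) := by
  have hshift : Tendsto (fun h : ℝ => a + h) (𝓝[>] 0) (𝓝[Icc a c \ {a}] a) := by
    refine tendsto_nhdsWithin_iff.2
      ⟨(Continuous.tendsto' (by fun_prop) 0 a (by simp)).mono_left nhdsWithin_le_nhds, ?_⟩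
    filter_upwards [Ioo_mem_nhdsGT (sub_pos.2 hac)] with h hh
    exact ⟨⟨by linarith [hh.1], by linarith [hh.2]⟩, by simpa using hh.1.ne'⟩
  refine ((hasDerivWithinAt_iff_tendsto_slope.1 hf).comp hshift).congr fun h => ?_
  simp [slope, diffQuot]

theorem tendsto_diffQuot_right {f : ℝ → E} {v : E} (hac : a < c)
    (hf : HasDerivWithinAt f v (Icc a c) c) :
    Tendsto (fun h => diffQuot h f (c - h)) (𝓝[>] 0) (𝓝 v) := by
  have hshift : Tendsto (fun h : ℝ => c - h) (𝓝[>] 0) (𝓝[Icc a c \ {c}] c) := by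
    refine tendsto_nhdsWithin_iff.2
      ⟨(Continuous.tendsto' (by fun_prop) 0 c (by simp)).mono_left nhdsWithin_le_nhds, ?_⟩
    filter_upwards [Ioo_mem_nhdsGT (sub_pos.2 hac)] with h hh
    exact ⟨⟨by linarith [hh.2], by linarith [hh.1]⟩, by simpa using hh.1.ne'⟩
  refine ((hasDerivWithinAt_iff_tendsto_slope.1 hf).comp hshift).congr fun h => ?_
  simp only [Function.comp, diffQuot, slope, sub_sub_cancel_left, vsub_eq_sub, sub_add_cancel,
    inv_neg, neg_smul, ← smul_neg, neg_sub]

theorem hasDerivAt_diffQuot {f f' : ℝ → E}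
    (hf : ∀ r ∈ Icc a c, HasDerivWithinAt f (f' r) (Icc a c) r) (hh : 0 ≤ h) {s : ℝ}
    (hs : s ∈ Ioo a (c - h)) : HasDerivAt (diffQuot h f) (diffQuot h f' s) s := by
  have hat : ∀ r ∈ Ioo a c, HasDerivAt f (f' r) r := fun r hr =>
    (hf r (Ioo_subset_Icc_self hr)).hasDerivAt (Icc_mem_nhds hr.1 hr.2)
  exact (((hat (s + h) ⟨by linarith [hs.1], by linarith [hs.2]⟩).comp_add_const s h).sub
    (hat s ⟨hs.1, by linarith [hs.2]⟩)).const_smul h⁻¹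

theorem diffQuot_integral_eq_intervalAverage {g : ℝ → E} (hg : LocallyIntegrable g)
    (a h s : ℝ) : diffQuot h (fun s => ∫ r in a..s, g r) s = ⨍ r in s..s + h, g r := by
  have hint : ∀ r s, IntervalIntegrable g volume r s := fun r s =>
    (hg.integrableOn_isCompact isCompact_uIcc).intervalIntegrable
  rw [interval_average_eq, add_sub_cancel_left, diffQuot,
    intervalIntegral.integral_interval_sub_left (hint _ _) (hint _ _)]

variable [CompleteSpace E]

theorem diffQuot_eq_intervalAverage {f f' : ℝ → E}
    (hf : ∀ r ∈ Icc a c, HasDerivWithinAt f (f' r) (Icc a c) r) (hf' : ContinuousOn f' (Icc a c))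
    (hh : 0 ≤ h) {s : ℝ} (hs : s ∈ Icc a (c - h)) :
    diffQuot h f s = ⨍ r in s..s + h, f' r := by
  have hsub : Icc s (s + h) ⊆ Icc a c := Icc_subset_Icc hs.1 (by linarith [hs.2])
  rw [interval_average_eq, add_sub_cancel_left, diffQuot]
  congr 1
  refine (intervalIntegral.integral_eq_sub_of_hasDerivAt_of_le (by linarith)
    (fun r hr => ((hf r (hsub hr)).mono hsub).continuousWithinAt) (fun r hr => ?_) ?_).symm
  · exact ((hf r (hsub (Ioo_subset_Icc_self hr))).mono hsub).hasDerivAt (Icc_mem_nhds hr.1 hr.2)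
  · exact (hf'.mono ((uIcc_of_le (by linarith : s ≤ s + h)).trans_subset hsub)).intervalIntegrable

theorem hasDerivWithinAt_integral_Icc {g : ℝ → E} (hg : ContinuousOn g (Icc a c)) {s : ℝ}
    (hs : s ∈ Icc a c) : HasDerivWithinAt (fun s => ∫ r in a..s, g r) (g s) (Icc a c) s := by
  have : Fact (s ∈ Icc a c) := ⟨hs⟩
  exact intervalIntegral.integral_hasDerivWithinAt_right
    (hg.mono ((uIcc_of_le hs.1).trans_subset (Icc_subset_Icc_right hs.2))).intervalIntegrable
    (hg.stronglyMeasurableAtFilter_nhdsWithin measurableSet_Icc s) (hg s hs)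

end DifferenceQuotients

section ShrinkingIntervals

theorem memLp_of_continuousOn_Icc {E : Type*} [NormedAddCommGroup E] {f : ℝ → E} {a c : ℝ}
    (hf : ContinuousOn f (Icc a c)) (p : ENNReal) : MemLp f p (volume.restrict (Ioo a c)) := by
  obtain ⟨C, hC⟩ := isCompact_Icc.exists_bound_of_continuousOn hf
  refine MemLp.of_bound ((hf.mono Ioo_subset_Icc_self).aestronglyMeasurable measurableSet_Ioo) C ?_
  exact (ae_restrict_mem measurableSet_Ioo).mono fun s hs => hC s (Ioo_subset_Icc_self hs)

theorem tendsto_eLpNorm_indicator_of_tendsto_measure {α ι E : Type*} [MeasurableSpace α]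
    {μ : Measure α} [NormedAddCommGroup E] {p : ENNReal} (hp : 1 ≤ p) (hp' : p ≠ ⊤) {f : α → E}
    (hf : MemLp f p μ) {l : Filter ι} {A : ι → Set α} (hA : ∀ i, MeasurableSet (A i))
    (hμA : Tendsto (fun i => μ (A i)) l (𝓝 0)) :
    Tendsto (fun i => eLpNorm ((A i).indicator f) p μ) l (𝓝 0) := by
  refine ENNReal.tendsto_nhds_zero.2 fun ε hε => ?_
  obtain ⟨r, hr, hrε⟩ : ∃ r : ℝ, 0 < r ∧ ENNReal.ofReal r ≤ ε := by
    obtain ⟨r, hr, hrε⟩ := ENNReal.lt_iff_exists_nnreal_btwn.1 hε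
    exact ⟨r, by exact_mod_cast hr, by simpa using hrε.le⟩
  obtain ⟨δ, hδ, hle⟩ := hf.eLpNorm_indicator_le hp hp' hr
  filter_upwards [ENNReal.tendsto_nhds_zero.1 hμA _ (ENNReal.ofReal_pos.2 hδ)] with i hi
  exact (hle _ (hA i) hi).trans hrε

variable {X : Type*} [NormedAddCommGroup X]

/-- `Yh h → Y` in `L²` as `h ↓ 0`, the norm at step `h` being that of `L²(a, c - h)`, where
difference quotients with step `h` of functions on `[a, c]` live. -/
def TendstoL2Shrinking (a c : ℝ) (Yh : ℝ → ℝ → X) (Y : ℝ → X) : Prop :=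
  Tendsto (fun h => eLpNorm (Yh h - Y) 2 (volume.restrict (Ioo a (c - h)))) (𝓝[>] 0) (𝓝 0)

variable {a c e : ℝ} {Yh : ℝ → ℝ → X} {Y Z : ℝ → X}

namespace TendstoL2Shrinking

theorem congr {Zh : ℝ → ℝ → X} (hY : TendstoL2Shrinking a c Yh Y)
    (hYZh : ∀ h > 0, ∀ s ∈ Ioo a (c - h), Yh h s = Zh h s) (hYZ : ∀ s ∈ Ioo a c, Y s = Z s) :
    TendstoL2Shrinking a c Zh Z := by
  refine Tendsto.congr' ?_ hY
  filter_upwards [self_mem_nhdsWithin] with h hh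
  refine eLpNorm_congr_ae ((ae_restrict_mem measurableSet_Ioo).mono fun s hs => ?_)
  have hs' : s ∈ Ioo a c := ⟨hs.1, hs.2.trans (sub_lt_self c hh)⟩
  simp only [Pi.sub_apply, hYZh h hh s hs, hYZ s hs']

theorem mono_right (hY : TendstoL2Shrinking a c Yh Y) (hec : e ≤ c) :
    TendstoL2Shrinking a e Yh Y :=
  tendsto_of_tendsto_of_tendsto_of_le_of_le tendsto_const_nhds hY (fun _ => zero_le) fun _ =>
    eLpNorm_mono_measure _ (Measure.restrict_mono_set _ (Ioo_subset_Ioo_right (by linarith)))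

theorem clm_apply {X' : Type*} [NormedSpace ℝ X] [NormedAddCommGroup X'] [NormedSpace ℝ X']
    {Λ : ℝ → X →L[ℝ] X'} (hΛ : MemLp Λ ⊤ (volume.restrict (Ioo a c)))
    (hY : TendstoL2Shrinking a c Yh Y) :
    TendstoL2Shrinking a c (fun h s => Λ s (Yh h s)) fun s => Λ s (Y s) := by
  set C := eLpNorm Λ ⊤ (volume.restrict (Ioo a c))
  have hC : C ≠ ⊤ := hΛ.eLpNorm_ne_top
  have hΛC : ∀ᵐ s ∂volume.restrict (Ioo a c), ‖Λ s‖ ≤ C.toReal := by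
    filter_upwards [ae_le_eLpNormEssSup (f := Λ) (μ := volume.restrict (Ioo a c))] with s hs
    rw [← toReal_enorm]
    exact ENNReal.toReal_mono hC (by rwa [← eLpNorm_exponent_top] at hs)
  have hlim : Tendsto (fun h => ENNReal.ofReal C.toReal *
      eLpNorm (Yh h - Y) 2 (volume.restrict (Ioo a (c - h)))) (𝓝[>] 0) (𝓝 0) := by
    simpa using ENNReal.Tendsto.const_mul hY (Or.inr ENNReal.ofReal_ne_top)
  refine tendsto_of_tendsto_of_tendsto_of_le_of_le' tendsto_const_nhds hlim
    (Eventually.of_forall fun _ => zero_le) ?_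
  filter_upwards [self_mem_nhdsWithin] with h hh
  refine eLpNorm_le_mul_eLpNorm_of_ae_le_mul ?_ 2
  filter_upwards [ae_mono (Measure.restrict_mono_set volume
    (Ioo_subset_Ioo_right (sub_le_self c (le_of_lt hh)))) hΛC] with s hs
  simp only [Pi.sub_apply, ← map_sub]
  exact (Λ s).le_of_opNorm_le hs _

theorem tendsto_eLpNorm_indicator (hY : TendstoL2Shrinking a c Yh Y)
    (hYh : ∀ᶠ h in 𝓝[>] 0, AEStronglyMeasurable (Yh h) (volume.restrict (Ioo a (c - h))))
    (hY2 : MemLp Y 2 (volume.restrict (Ioo a c))) :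
    Tendsto (fun h => eLpNorm ((Ioo a (c - h)).indicator (Yh h) - (Ioo a c).indicator Y) 2 volume)
      (𝓝[>] 0) (𝓝 0) := by
  set Z := (Ioo a c).indicator Y with hZ
  have hZ2 : MemLp Z 2 volume := (memLp_indicator_iff_restrict measurableSet_Ioo).2 hY2
  have hvol : Tendsto (fun h : ℝ => volume (Ico (c - h) c)) (𝓝[>] 0) (𝓝 0) := by
    simp only [Real.volume_Ico, sub_sub_cancel]
    exact (ENNReal.continuous_ofReal.tendsto' 0 0 (by simp)).mono_left nhdsWithin_le_nhds
  have hsum := Tendsto.add hY (tendsto_eLpNorm_indicator_of_tendsto_measure one_le_two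
    ENNReal.ofNat_ne_top hZ2 (fun _ => measurableSet_Ico) hvol)
  rw [add_zero] at hsum
  refine tendsto_of_tendsto_of_tendsto_of_le_of_le' tendsto_const_nhds hsum
    (Eventually.of_forall fun _ => zero_le) ?_
  filter_upwards [hYh, self_mem_nhdsWithin] with h hm hh
  have hsplit : (Ioo a (c - h)).indicator (Yh h) - Z =
      (Ioo a (c - h)).indicator (Yh h - Y) - (Ico (c - h) c).indicator Z := by
    funext s
    have hh : (0 : ℝ) < h := hh
    by_cases h1 : s ∈ Ioo a (c - h)
    · have h2 : s ∈ Ioo a c := ⟨h1.1, by linarith [h1.2]⟩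
      simp [hZ, h1, h2, not_le.2 h1.2]
    · by_cases h2 : s ∈ Ioo a c
      · have h3 : s ∈ Ico (c - h) c := ⟨not_lt.1 fun h3 => h1 ⟨h2.1, h3⟩, h2.2⟩
        simp [hZ, h1, h2, h3]
      · simp [hZ, h1, h2]
  rw [hsplit, ← eLpNorm_indicator_eq_eLpNorm_restrict measurableSet_Ioo]
  refine eLpNorm_sub_le ?_ (hZ2.1.indicator measurableSet_Ico) one_le_two
  exact (aestronglyMeasurable_indicator_iff measurableSet_Ioo).2
    (hm.sub (hY2.1.mono_measure (Measure.restrict_mono_set _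
      (Ioo_subset_Ioo_right (sub_le_self c (le_of_lt hh))))))

theorem ae_unique (hY : TendstoL2Shrinking a c Yh Y) (hZ : TendstoL2Shrinking a c Yh Z)
    (hYh : ∀ᶠ h in 𝓝[>] 0, AEStronglyMeasurable (Yh h) (volume.restrict (Ioo a (c - h))))
    (hY2 : MemLp Y 2 (volume.restrict (Ioo a c))) (hZ2 : MemLp Z 2 (volume.restrict (Ioo a c))) :
    Y =ᵐ[volume.restrict (Ioo a c)] Z := by
  have hYm := (aestronglyMeasurable_indicator_iff measurableSet_Ioo).2 hY2.1
  have hZm := (aestronglyMeasurable_indicator_iff measurableSet_Ioo).2 hZ2.1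
  have hsum := (hY.tendsto_eLpNorm_indicator hYh hY2).add (hZ.tendsto_eLpNorm_indicator hYh hZ2)
  rw [add_zero] at hsum
  have hzero : eLpNorm ((Ioo a c).indicator Y - (Ioo a c).indicator Z) 2 volume ≤ 0 := by
    refine ge_of_tendsto hsum (hYh.mono fun h hm => ?_)
    have hm' := (aestronglyMeasurable_indicator_iff measurableSet_Ioo).2 hm
    rw [eLpNorm_sub_comm ((Ioo a (c - h)).indicator (Yh h)),
      ← sub_add_sub_cancel _ ((Ioo a (c - h)).indicator (Yh h))]
    exact eLpNorm_add_le (hYm.sub hm') (hm'.sub hZm) one_le_two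
  rw [nonpos_iff_eq_zero, eLpNorm_eq_zero_iff (hYm.sub hZm) two_ne_zero] at hzero
  rw [EventuallyEq, ae_restrict_iff' measurableSet_Ioo]
  filter_upwards [hzero] with s hs hmem
  simpa [hmem, sub_eq_zero] using hs

end TendstoL2Shrinking

variable [NormedSpace ℝ X]

theorem aestronglyMeasurable_diffQuot {f : ℝ → X} (hf : ContinuousOn f (Icc a c)) {h : ℝ}
    (hh : 0 ≤ h) : AEStronglyMeasurable (diffQuot h f) (volume.restrict (Ioo a (c - h))) :=
  ((continuousOn_diffQuot hf hh).mono Ioo_subset_Icc_self).aestronglyMeasurable measurableSet_Ioo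

theorem tendstoL2Shrinking_diffQuot [CompleteSpace X] {f f' : ℝ → X}
    (hf : ∀ r ∈ Icc a c, HasDerivWithinAt f (f' r) (Icc a c) r)
    (hf' : ContinuousOn f' (Icc a c)) : TendstoL2Shrinking a c (fun h => diffQuot h f) f' := by
  set K := (Ioo a c).indicator f'
  have hK2 : MemLp K 2 volume :=
    (memLp_indicator_iff_restrict measurableSet_Ioo).2 (memLp_of_continuousOn_Icc hf' 2)
  have hK_eq : ∀ r ∈ Ioo a c, K r = f' r := fun r hr => indicator_of_mem hr f'
  have hAv : TendstoL2Shrinking a c (fun h s => ⨍ r in s..s + h, K r) K :=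
    tendsto_of_tendsto_of_tendsto_of_le_of_le tendsto_const_nhds
      (tendsto_eLpNorm_intervalAverage_sub one_le_two hK2) (fun _ => zero_le)
      fun _ => eLpNorm_mono_measure _ Measure.restrict_le_self
  refine hAv.congr (fun h hh s hs => ?_) hK_eq
  rw [diffQuot_eq_intervalAverage hf hf' (le_of_lt hh) (Ioo_subset_Icc_self hs),
    interval_average_eq, interval_average_eq]
  congr 1
  refine intervalIntegral.integral_congr_ae ?_
  filter_upwards [Measure.ae_ne volume (s + h)] with r hr hrI
  rw [uIoc_of_le (by linarith)] at hrI
  exact hK_eq r ⟨hs.1.trans hrI.1, (lt_of_le_of_ne hrI.2 hr).trans_le (by linarith [hs.2])⟩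

end ShrinkingIntervals

namespace EnergySpace

variable {H : Type*} [NormedAddCommGroup H] [InnerProductSpace ℝ H] (S : H →ₗ.[ℝ] H)

theorem norm_sqrtMap (v : EnergySpace S) : ‖sqrtMap S v‖ = ‖v‖ := rfl

theorem inner_sqrtMap (v w : EnergySpace S) :
    inner ℝ (sqrtMap S v) (sqrtMap S w) = inner ℝ v w := rfl

theorem continuous_sqrtMap : Continuous (sqrtMap S) :=
  AddMonoidHomClass.continuous_of_bound (sqrtMap S) 1 fun v => by rw [norm_sqrtMap, one_mul]

end EnergySpace

theorem continuous_intervalAverage {E : Type*} [NormedAddCommGroup E] [NormedSpace ℝ E]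
    {G : ℝ → E} (hG : LocallyIntegrable G) (h : ℝ) :
    Continuous fun s => ⨍ r in s..s + h, G r := by
  have hprim : Continuous fun s => ∫ r in (0 : ℝ)..s, G r :=
    intervalIntegral.continuous_primitive (fun r s =>
      (hG.integrableOn_isCompact isCompact_uIcc).intervalIntegrable) 0
  simp only [← diffQuot_integral_eq_intervalAverage hG 0]
  exact ((hprim.comp (continuous_add_const h)).sub hprim).const_smul _

theorem intervalIntegrable_inner_const {E : Type*} [NormedAddCommGroup E] [InnerProductSpace ℝ E]
    {f : ℝ → E} {a c : ℝ} (hf : IntervalIntegrable f volume a c) (v : E) :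
    IntervalIntegrable (fun r => (inner ℝ (f r) v : ℝ)) volume a c :=
  ⟨Integrable.inner_const hf.1 v, Integrable.inner_const hf.2 v⟩

theorem intervalIntegral_inner_const {E : Type*} [NormedAddCommGroup E] [InnerProductSpace ℝ E]
    [CompleteSpace E] {f : ℝ → E} {a c : ℝ} (hf : IntervalIntegrable f volume a c) (v : E) :
    ∫ r in a..c, inner ℝ (f r) v = inner ℝ (∫ r in a..c, f r) v := by
  simp only [real_inner_comm v]
  exact (innerSL ℝ v).intervalIntegral_comp_comm hf

theorem intervalIntegral_congr_Ioo {E : Type*} [NormedAddCommGroup E] [NormedSpace ℝ E]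
    {f g : ℝ → E} {a c s : ℝ} (hs : s ∈ Icc a c) (h : ∀ r ∈ Ioo a c, f r = g r) :
    ∫ r in a..s, f r = ∫ r in a..s, g r := by
  rw [intervalIntegral.integral_of_le hs.1, intervalIntegral.integral_of_le hs.1,
    integral_Ioc_eq_integral_Ioo, integral_Ioc_eq_integral_Ioo]
  exact setIntegral_congr_fun measurableSet_Ioo fun r hr => h r ⟨hr.1, hr.2.trans_le hs.2⟩

section EnergyBalance

variable {H : Type*} [NormedAddCommGroup H] [InnerProductSpace ℝ H]
  {U : Type*} [NormedAddCommGroup U] [InnerProductSpace ℝ U] [CompleteSpace U]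
  {X : Type*} [NormedAddCommGroup X] [InnerProductSpace ℝ X] [CompleteSpace X]
  {S : H →ₗ.[ℝ] H} {B : ℝ → U →L[ℝ] StrongDual ℝ (EnergySpace S)} {f : ℝ → H} {a c e : ℝ}
  {w : ℝ → EnergySpace S} {w' : ℝ → H} {z : ℝ → U}

namespace IsWeakSolution

theorem mono_right (hw : IsWeakSolution B f a (Icc a c) w w' z) (hec : e ≤ c) :
    IsWeakSolution B f a (Icc a e) w w' z :=
  have hsub : Icc a e ⊆ Icc a c := Icc_subset_Icc_right hec
  { continuousOn := hw.continuousOn.mono hsub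
    continuousOn_deriv := hw.continuousOn_deriv.mono hsub
    hasDeriv := fun s hs => (hw.hasDeriv s (hsub hs)).mono hsub
    weak_eq := fun φ s hs => hw.weak_eq φ s (hsub hs) }

theorem continuousOn_toH (hw : IsWeakSolution B f a (Icc a c) w w' z) :
    ContinuousOn (fun s => EnergySpace.toH S (w s)) (Icc a c) :=
  fun s hs => (hw.hasDeriv s hs).continuousWithinAt

theorem continuousOn_sqrtMap (hw : IsWeakSolution B f a (Icc a c) w w' z) :
    ContinuousOn (fun s => EnergySpace.sqrtMap S (w s)) (Icc a c) :=
  (EnergySpace.continuous_sqrtMap S).comp_continuousOn hw.continuousOn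

variable [CompleteSpace H]

theorem weak_eq_primitive (hw : IsWeakSolution B f a (Icc a c) w w' z) (L : EnergySpace S →ₗ[ℝ] X)
    {G : ℝ → X} (hG : LocallyIntegrable G)
    (hGL : ∀ φ, ∀ s ∈ Ioo a c, inner ℝ (z s) (dualAdjoint (B s) φ) +
      inner ℝ (f s) (EnergySpace.toH S φ) = inner ℝ (G s) (L φ))
    (φ : EnergySpace S) {s : ℝ} (hs : s ∈ Icc a c) :
    inner ℝ (w' s) (EnergySpace.toH S φ) - inner ℝ (w' a) (EnergySpace.toH S φ) +
      (inner ℝ (∫ r in a..s, EnergySpace.sqrtMap S (w r)) (EnergySpace.sqrtMap S φ) +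
        inner ℝ (∫ r in a..s, G r) (L φ)) = 0 := by
  have hq : IntervalIntegrable (fun r => EnergySpace.sqrtMap S (w r)) volume a s :=
    (hw.continuousOn_sqrtMap.mono
      ((uIcc_of_le hs.1).trans_subset (Icc_subset_Icc_right hs.2))).intervalIntegrable
  have hGi : IntervalIntegrable G volume a s :=
    (hG.integrableOn_isCompact isCompact_uIcc).intervalIntegrable
  rw [← hw.weak_eq φ s hs, ← intervalIntegral_inner_const hq, ← intervalIntegral_inner_const hGi,
    ← intervalIntegral.integral_add (intervalIntegrable_inner_const hq _)
      (intervalIntegrable_inner_const hGi _)]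
  congr 1
  refine intervalIntegral_congr_Ioo hs fun r hr => ?_
  rw [EnergySpace.inner_sqrtMap, add_assoc, hGL φ r hr]

theorem inner_diffQuot_add_eq (hw : IsWeakSolution B f a (Icc a c) w w' z)
    (L : EnergySpace S →ₗ[ℝ] X) {G : ℝ → X} (hG : LocallyIntegrable G)
    (hGL : ∀ φ, ∀ s ∈ Ioo a c, inner ℝ (z s) (dualAdjoint (B s) φ) +
      inner ℝ (f s) (EnergySpace.toH S φ) = inner ℝ (G s) (L φ))
    (φ : EnergySpace S) {h s : ℝ} (hs : s ∈ Icc a c) (hsh : s + h ∈ Icc a c) :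
    inner ℝ (diffQuot h w' s) (EnergySpace.toH S φ) +
      inner ℝ (diffQuot h (fun s => ∫ r in a..s, EnergySpace.sqrtMap S (w r)) s)
        (EnergySpace.sqrtMap S φ) =
      -inner ℝ (⨍ r in s..s + h, G r) (L φ) := by
  rw [← diffQuot_integral_eq_intervalAverage hG a]
  simp only [diffQuot, real_inner_smul_left, inner_sub_left]
  linear_combination h⁻¹ * hw.weak_eq_primitive L hG hGL φ hsh -
    h⁻¹ * hw.weak_eq_primitive L hG hGL φ hs

theorem diffQuot_energy_sub_eq (hw : IsWeakSolution B f a (Icc a c) w w' z)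
    (L : EnergySpace S →ₗ[ℝ] X) (hLw : ContinuousOn (fun s => L (w s)) (Icc a c)) {G : ℝ → X}
    (hG : LocallyIntegrable G)
    (hGL : ∀ φ, ∀ s ∈ Ioo a c, inner ℝ (z s) (dualAdjoint (B s) φ) +
      inner ℝ (f s) (EnergySpace.toH S φ) = inner ℝ (G s) (L φ))
    {h : ℝ} (hh : 0 ≤ h) (hhc : h ≤ c - a) {p Q : ℝ → H}
    (hp : p = fun s => EnergySpace.toH S (w s))
    (hQ : Q = fun s => ∫ r in a..s, EnergySpace.sqrtMap S (w r)) :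
    (‖diffQuot h p (c - h)‖ ^ 2 + ‖diffQuot h Q (c - h)‖ ^ 2) / 2 -
        (‖diffQuot h p a‖ ^ 2 + ‖diffQuot h Q a‖ ^ 2) / 2 =
      -∫ s in a..c - h, inner ℝ (⨍ r in s..s + h, G r) (diffQuot h (fun s => L (w s)) s) := by
  have hac : a ≤ c - h := by linarith
  have hQ' : ∀ s ∈ Icc a c, HasDerivWithinAt Q (EnergySpace.sqrtMap S (w s)) (Icc a c) s :=
    fun s hs => hQ ▸ hasDerivWithinAt_integral_Icc hw.continuousOn_sqrtMap hs
  have hQc : ContinuousOn Q (Icc a c) := fun s hs => (hQ' s hs).continuousWithinAt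
  have hpc : ContinuousOn p (Icc a c) := hp ▸ hw.continuousOn_toH
  rw [← intervalIntegral.integral_neg]
  refine (intervalIntegral.integral_eq_sub_of_hasDerivAt_of_le hac (f := fun s =>
    (‖diffQuot h p s‖ ^ 2 + ‖diffQuot h Q s‖ ^ 2) / 2) ?_ (fun s hs => ?_) ?_).symm
  · exact (((continuousOn_diffQuot hpc hh).norm.pow 2).add
      ((continuousOn_diffQuot hQc hh).norm.pow 2)).div_const 2
  · have hs₁ : s ∈ Icc a c := ⟨hs.1.le, by linarith [hs.2]⟩
    have hs₂ : s + h ∈ Icc a c := ⟨by linarith [hs.1], by linarith [hs.2]⟩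
    have hweak := hw.inner_diffQuot_add_eq L hG hGL (diffQuot h w s) hs₁ hs₂
    rw [map_diffQuot, map_diffQuot, map_diffQuot, ← hp, ← hQ] at hweak
    refine (((hasDerivAt_diffQuot (hp ▸ hw.hasDeriv) hh hs).norm_sq.add
      (hasDerivAt_diffQuot hQ' hh hs).norm_sq).div_const 2).congr_deriv ?_
    rw [← hweak, real_inner_comm (diffQuot h p s)]
    ring
  · refine ContinuousOn.intervalIntegrable ?_
    rw [uIcc_of_le hac]
    exact ((continuous_intervalAverage hG h).continuousOn.inner (continuousOn_diffQuot hLw hh)).neg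

theorem tendsto_diffQuot_energy (hw : IsWeakSolution B f a (Icc a c) w w' z) (hac : a < c)
    {p Q : ℝ → H} (hp : p = fun s => EnergySpace.toH S (w s))
    (hQ : Q = fun s => ∫ r in a..s, EnergySpace.sqrtMap S (w r)) :
    Tendsto (fun h => (‖diffQuot h p (c - h)‖ ^ 2 + ‖diffQuot h Q (c - h)‖ ^ 2) / 2 -
      (‖diffQuot h p a‖ ^ 2 + ‖diffQuot h Q a‖ ^ 2) / 2) (𝓝[>] 0)
      (𝓝 (standardEnergy (w c) (w' c) - standardEnergy (w a) (w' a))) := by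
  have ha : a ∈ Icc a c := left_mem_Icc.2 hac.le
  have hc : c ∈ Icc a c := right_mem_Icc.2 hac.le
  have hQ' : ∀ s ∈ Icc a c, HasDerivWithinAt Q (EnergySpace.sqrtMap S (w s)) (Icc a c) s :=
    fun s hs => hQ ▸ hasDerivWithinAt_integral_Icc hw.continuousOn_sqrtMap hs
  have hp' : ∀ s ∈ Icc a c, HasDerivWithinAt p (w' s) (Icc a c) s := hp ▸ hw.hasDeriv
  simp only [standardEnergy, ← EnergySpace.norm_sqrtMap, add_comm (‖EnergySpace.sqrtMap S _‖ ^ 2)]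
  exact ((((tendsto_diffQuot_right hac (hp' c hc)).norm.pow 2).add
    ((tendsto_diffQuot_right hac (hQ' c hc)).norm.pow 2)).div_const 2).sub
    ((((tendsto_diffQuot_left hac (hp' a ha)).norm.pow 2).add
    ((tendsto_diffQuot_left hac (hQ' a ha)).norm.pow 2)).div_const 2)

end IsWeakSolution

theorem tendsto_integral_inner_intervalAverage_diffQuot {ℓ : ℝ → X}
    (hℓ : ContinuousOn ℓ (Icc a c)) {K Y : ℝ → X} (hK : MemLp K 2 volume)
    (hY : MemLp Y 2 (volume.restrict (Ioo a c)))
    (hℓY : TendstoL2Shrinking a c (fun h => diffQuot h ℓ) Y) (hac : a < c) :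
    Tendsto (fun h => ∫ s in a..c - h, inner ℝ (⨍ r in s..s + h, K r) (diffQuot h ℓ s))
      (𝓝[>] 0) (𝓝 (∫ s in a..c, inner ℝ (K s) (Y s))) := by
  have hKloc : LocallyIntegrable K := hK.locallyIntegrable one_le_two
  have hmeas : ∀ᶠ h in 𝓝[>] 0,
      AEStronglyMeasurable (diffQuot h ℓ) (volume.restrict (Ioo a (c - h))) :=
    eventually_mem_nhdsWithin.mono fun h hh => aestronglyMeasurable_diffQuot hℓ (le_of_lt hh)
  have hAv : ∀ h, AEStronglyMeasurable fun s => ⨍ r in s..s + h, K r := fun h =>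
    (continuous_intervalAverage hKloc h).aestronglyMeasurable
  have hind : ∀ (g y : ℝ → X) {b : ℝ}, a ≤ b →
      ∫ s, inner ℝ (g s) ((Ioo a b).indicator y s) = ∫ s in a..b, inner ℝ (g s) (y s) := by
    intro g y b hab
    rw [intervalIntegral.integral_of_le hab, integral_Ioc_eq_integral_Ioo,
      ← integral_indicator measurableSet_Ioo]
    refine integral_congr_ae (Eventually.of_forall fun s => ?_)
    by_cases hs : s ∈ Ioo a b <;> simp [hs]
  have hlim := tendsto_integral_inner_of_tendsto_eLpNorm_sub (Eventually.of_forall hAv) hK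
    (hmeas.mono fun h hm => (aestronglyMeasurable_indicator_iff measurableSet_Ioo).2 hm)
    ((memLp_indicator_iff_restrict measurableSet_Ioo).2 hY)
    (tendsto_eLpNorm_intervalAverage_sub one_le_two hK) (hℓY.tendsto_eLpNorm_indicator hmeas hY)
  rw [hind _ _ hac.le] at hlim
  refine hlim.congr' ?_
  filter_upwards [Ioo_mem_nhdsGT (sub_pos.2 hac)] with h hh
  exact hind _ _ (by linarith [hh.2])

theorem IsWeakSolution.standardEnergy_sub_eq [CompleteSpace H]
    (hw : IsWeakSolution B f a (Icc a c) w w' z)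
    (L : EnergySpace S →ₗ[ℝ] X) (hLw : ContinuousOn (fun s => L (w s)) (Icc a c)) {G Y : ℝ → X}
    (hG : MemLp G 2 (volume.restrict (Ioo a c))) (hY : MemLp Y 2 (volume.restrict (Ioo a c)))
    (hLY : TendstoL2Shrinking a c (fun h => diffQuot h fun s => L (w s)) Y)
    (hGL : ∀ φ, ∀ s ∈ Ioo a c, inner ℝ (z s) (dualAdjoint (B s) φ) +
      inner ℝ (f s) (EnergySpace.toH S φ) = inner ℝ (G s) (L φ))
    (he : e ∈ Icc a c) :
    standardEnergy (w e) (w' e) - standardEnergy (w a) (w' a) =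
      -∫ s in a..e, inner ℝ (G s) (Y s) := by
  rcases he.1.eq_or_lt with rfl | hae
  · simp
  have hle : volume.restrict (Ioo a e) ≤ volume.restrict (Ioo a c) :=
    Measure.restrict_mono_set _ (Ioo_subset_Ioo_right he.2)
  set K := (Ioo a e).indicator G
  have hK2 : MemLp K 2 volume :=
    (memLp_indicator_iff_restrict measurableSet_Ioo).2 (hG.mono_measure hle)
  have hKG : ∀ s ∈ Ioo a e, K s = G s := fun s hs => indicator_of_mem hs G
  have hwe := hw.mono_right he.2
  have hLwe := hLw.mono (Icc_subset_Icc_right he.2)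
  have hdiss := (tendsto_integral_inner_intervalAverage_diffQuot hLwe hK2 (hY.mono_measure hle)
    (hLY.mono_right he.2) hae).neg
  have hKY : ∫ s in a..e, inner ℝ (K s) (Y s) = ∫ s in a..e, inner ℝ (G s) (Y s) :=
    intervalIntegral_congr_Ioo (right_mem_Icc.2 he.1) fun s hs => by rw [hKG s hs]
  rw [hKY] at hdiss
  refine tendsto_nhds_unique (hwe.tendsto_diffQuot_energy hae rfl rfl) (hdiss.congr' ?_)
  filter_upwards [Ioo_mem_nhdsGT (sub_pos.2 hae)] with h hh
  refine (hwe.diffQuot_energy_sub_eq L hLwe (hK2.locallyIntegrable one_le_two)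
    (fun φ s hs => ?_) hh.1.le hh.2.le rfl rfl).symm
  rw [hKG s hs, hGL φ s ⟨hs.1, hs.2.trans_le he.2⟩]

end EnergyBalance

section Damping

/-- The operator `B^* : V → U` of `dualAdjoint` as a bounded operator. -/
noncomputable def dualAdjointCLM {U V : Type*} [NormedAddCommGroup U] [InnerProductSpace ℝ U]
    [CompleteSpace U] [SeminormedAddCommGroup V] [NormedSpace ℝ V]
    (B : U →L[ℝ] StrongDual ℝ V) : V →L[ℝ] U :=
  (InnerProductSpace.toDual ℝ U).symm.toContinuousLinearEquiv.toContinuousLinearMap ∘L B.flip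

theorem dualAdjointCLM_apply {U V : Type*} [NormedAddCommGroup U] [InnerProductSpace ℝ U]
    [CompleteSpace U] [SeminormedAddCommGroup V] [NormedSpace ℝ V]
    (B : U →L[ℝ] StrongDual ℝ V) (v : V) : dualAdjointCLM B v = dualAdjoint B v := rfl

theorem dualAdjoint_smul_left {U V : Type*} [NormedAddCommGroup U] [InnerProductSpace ℝ U]
    [CompleteSpace U] [SeminormedAddCommGroup V] [NormedSpace ℝ V]
    (r : ℝ) (B : U →L[ℝ] StrongDual ℝ V) (v : V) : dualAdjoint (r • B) v = r • dualAdjoint B v :=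
  ext_inner_right ℝ fun x => by simp [inner_smul_left, inner_dualAdjoint]

theorem dualAdjoint_zero_left {U V : Type*} [NormedAddCommGroup U] [InnerProductSpace ℝ U]
    [CompleteSpace U] [SeminormedAddCommGroup V] [NormedSpace ℝ V] (v : V) :
    dualAdjoint (0 : U →L[ℝ] StrongDual ℝ V) v = 0 :=
  ext_inner_right ℝ fun x => by simp [inner_dualAdjoint]

theorem eq_zero_of_dualAdjoint_eq_zero {U V : Type*} [NormedAddCommGroup U]
    [InnerProductSpace ℝ U] [CompleteSpace U] [SeminormedAddCommGroup V] [NormedSpace ℝ V]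
    {B : U →L[ℝ] StrongDual ℝ V} (hB : ∀ v, dualAdjoint B v = 0) : B = 0 := by
  ext x v
  simp [← inner_dualAdjoint, hB v]

theorem memLp_clm_apply {α E F : Type*} [MeasurableSpace α] {μ : Measure α}
    [NormedAddCommGroup E] [NormedSpace ℝ E] [NormedAddCommGroup F] [NormedSpace ℝ F]
    {p : ENNReal} {Λ : α → E →L[ℝ] F} (hΛ : MemLp Λ ⊤ μ) {f : α → E} (hf : MemLp f p μ) :
    MemLp (fun s => Λ s (f s)) p μ :=
  hΛ.of_bilin (fun (Λ : E →L[ℝ] F) x => Λ x) 1 hf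
    (isBoundedBilinearMap_apply.continuous.comp_aestronglyMeasurable (hΛ.1.prodMk hf.1))
    (Eventually.of_forall fun s => by simpa using (Λ s).le_opNNNorm (f s))

theorem memLp_adjoint {α E F : Type*} [MeasurableSpace α] {μ : Measure α}
    [NormedAddCommGroup E] [InnerProductSpace ℝ E] [CompleteSpace E]
    [NormedAddCommGroup F] [InnerProductSpace ℝ F] [CompleteSpace F]
    {p : ENNReal} {Λ : α → E →L[ℝ] F} (hΛ : MemLp Λ p μ) :
    MemLp (fun s => ContinuousLinearMap.adjoint (Λ s)) p μ :=
  hΛ.of_le (ContinuousLinearMap.adjoint.continuous.comp_aestronglyMeasurable hΛ.1)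
    (Eventually.of_forall fun s => (LinearIsometryEquiv.norm_map _ (Λ s)).le)

variable {H : Type*} [NormedAddCommGroup H] [InnerProductSpace ℝ H]
  {U : Type*} [NormedAddCommGroup U] [InnerProductSpace ℝ U]
  {S : H →ₗ.[ℝ] H} {B : ℝ → U →L[ℝ] StrongDual ℝ (EnergySpace S)} {a c e : ℝ}
  {w : ℝ → EnergySpace S} {w' : ℝ → H} {z : ℝ → U}

/-- The two kinds of damping for which the energy identity holds: `B` takes values in `L(U, H)`
and is essentially bounded on `(a, c)`, or `B = r C` on `(a, c)` with `C ∈ L(U, V')` and a scalar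
function `r` such that `r` and `1 / r` are essentially bounded. -/
def BoundedDamping (B : ℝ → U →L[ℝ] StrongDual ℝ (EnergySpace S)) (a c : ℝ) : Prop :=
  (∃ F : ℝ → U →L[ℝ] H, MemLp F ⊤ (volume.restrict (Ioo a c)) ∧
    ∀ s ∈ Ioo a c, ∀ x φ, B s x φ = inner ℝ (F s x) (EnergySpace.toH S φ)) ∨
  ∃ (r : ℝ → ℝ) (C : U →L[ℝ] StrongDual ℝ (EnergySpace S)),
    MemLp r ⊤ (volume.restrict (Ioo a c)) ∧ MemLp r⁻¹ ⊤ (volume.restrict (Ioo a c)) ∧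
    ∀ s ∈ Ioo a c, r s ≠ 0 ∧ B s = r s • C

theorem boundedDamping_of_eq_zero (hB : ∀ s ∈ Ioo a c, B s = 0) : BoundedDamping B a c :=
  .inl ⟨fun _ => 0, memLp_top_const 0, fun s hs x φ => by
    rw [hB s hs, zero_apply, zero_apply, zero_apply, inner_zero_left]⟩

theorem memLp_top_sqrt_and_inv {b : ℝ → ℝ}
    (hb : AEStronglyMeasurable b (volume.restrict (Ioo a c))) {β₀ β₁ : ℝ} (hβ₀ : 0 < β₀)
    (hbd : ∀ s ∈ Ioo a c, b s ∈ Icc β₀ β₁) :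
    MemLp (fun s => √(b s)) ⊤ (volume.restrict (Ioo a c)) ∧
      MemLp (fun s => √(b s))⁻¹ ⊤ (volume.restrict (Ioo a c)) := by
  have hsqrt : AEStronglyMeasurable (fun s => √(b s)) (volume.restrict (Ioo a c)) :=
    Real.continuous_sqrt.comp_aestronglyMeasurable hb
  constructor
  · refine memLp_top_of_bound hsqrt √β₁ ((ae_restrict_mem measurableSet_Ioo).mono fun s hs => ?_)
    rw [Real.norm_of_nonneg (Real.sqrt_nonneg _)]
    exact Real.sqrt_le_sqrt (hbd s hs).2
  · refine memLp_top_of_bound hsqrt.aemeasurable.inv.aestronglyMeasurable (√β₀)⁻¹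
      ((ae_restrict_mem measurableSet_Ioo).mono fun s hs => ?_)
    rw [Pi.inv_apply, Real.norm_of_nonneg (inv_nonneg.2 (Real.sqrt_nonneg _))]
    exact inv_anti₀ (Real.sqrt_pos.2 hβ₀) (Real.sqrt_le_sqrt (hbd s hs).1)

variable [CompleteSpace U]

/-- A lower bound for `b` on the half-open interval follows from the two-sided bound on `B^*`,
tested on one `v` with `B^* v ≠ 0`; `b > 0` alone would allow `b` to vanish at the end point. -/
theorem AdmissibleDamping.boundedDamping [CompleteSpace H] (hB : AdmissibleDamping B a c)
    {N : EnergySpace S → ℝ} {m M : ℝ} (hm : 0 < m)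
    (hN : ∀ s ∈ Ioo a c, ∀ v, m * N v ^ 2 ≤ ‖dualAdjoint (B s) v‖ ^ 2 ∧
      ‖dualAdjoint (B s) v‖ ^ 2 ≤ M * N v ^ 2) :
    BoundedDamping B a c := by
  rcases hB with ⟨F, hF, hBF⟩ | ⟨b, C, hb, hb0, hBC⟩
  · exact .inl ⟨F, memLp_of_continuousOn_Icc hF.continuousOn ⊤,
      fun s hs => hBF s (Ioo_subset_Ico_self hs)⟩
  by_cases hne : ∃ s₀ ∈ Ioo a c, ∃ v, dualAdjoint (B s₀) v ≠ 0
  · obtain ⟨s₀, hs₀, v, hv⟩ := hne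
    have hsq : ∀ s ∈ Ioo a c, ‖dualAdjoint (B s) v‖ ^ 2 = b s * ‖dualAdjoint C v‖ ^ 2 := by
      intro s hs
      rw [hBC s (Ioo_subset_Ico_self hs), dualAdjoint_smul_left, norm_smul, mul_pow,
        Real.norm_of_nonneg (Real.sqrt_nonneg _),
        Real.sq_sqrt (hb0 s (Ioo_subset_Ico_self hs)).le]
    have hBv : 0 < ‖dualAdjoint (B s₀) v‖ ^ 2 := pow_pos (norm_pos_iff.2 hv) 2
    have hCv : 0 < ‖dualAdjoint C v‖ ^ 2 :=
      pos_of_mul_pos_right (hsq s₀ hs₀ ▸ hBv) (hb0 s₀ (Ioo_subset_Ico_self hs₀)).le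
    have hNv : 0 < N v ^ 2 := by
      refine pow_two_pos_of_ne_zero fun hNv => ?_
      have hle := (hN s₀ hs₀ v).2
      rw [hNv, zero_pow two_ne_zero, mul_zero] at hle
      exact absurd hle (not_le.2 hBv)
    obtain ⟨hr, hr_inv⟩ := memLp_top_sqrt_and_inv hb.1.1 (div_pos (mul_pos hm hNv) hCv)
      fun s hs => ⟨(div_le_iff₀ hCv).2 (hsq s hs ▸ (hN s hs v).1),
        (le_div_iff₀ hCv).2 (hsq s hs ▸ (hN s hs v).2)⟩
    exact .inr ⟨_, C, hr, hr_inv, fun s hs =>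
      ⟨(Real.sqrt_pos.2 (hb0 s (Ioo_subset_Ico_self hs))).ne', hBC s (Ioo_subset_Ico_self hs)⟩⟩
  · push Not at hne
    exact boundedDamping_of_eq_zero fun s hs => eq_zero_of_dualAdjoint_eq_zero (hne s hs)

theorem HasVelocityTrace.tendstoL2Shrinking (hz : HasVelocityTrace B a c w z) :
    TendstoL2Shrinking a c (fun h s => dualAdjoint (B s) (diffQuot h w s)) z :=
  tendsto_lintegral_enorm_sq_iff_tendsto_eLpNorm.1 hz.2

variable [CompleteSpace H]

theorem dualAdjoint_eq_adjoint {T : U →L[ℝ] StrongDual ℝ (EnergySpace S)} {F : U →L[ℝ] H}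
    (hTF : ∀ x φ, T x φ = inner ℝ (F x) (EnergySpace.toH S φ)) (φ : EnergySpace S) :
    dualAdjoint T φ = ContinuousLinearMap.adjoint F (EnergySpace.toH S φ) :=
  ext_inner_right ℝ fun x => by
    rw [inner_dualAdjoint, hTF, ContinuousLinearMap.adjoint_inner_left, real_inner_comm]

theorem BoundedDamping.memLp_dualAdjoint (hB : BoundedDamping B a c) (φ : EnergySpace S) :
    MemLp (fun s => dualAdjoint (B s) φ) 2 (volume.restrict (Ioo a c)) := by
  rcases hB with ⟨F, hF, hBF⟩ | ⟨r, C, hr, -, hBC⟩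
  · refine (memLp_congr_ae ((ae_restrict_mem measurableSet_Ioo).mono fun s hs => ?_)).2
      (memLp_clm_apply (memLp_adjoint hF) (memLp_const (EnergySpace.toH S φ)))
    exact dualAdjoint_eq_adjoint (hBF s hs) φ
  · refine (memLp_congr_ae ((ae_restrict_mem measurableSet_Ioo).mono fun s hs => ?_)).2
      ((memLp_const (p := 2) (dualAdjoint C φ)).smul hr)
    rw [(hBC s hs).2, dualAdjoint_smul_left]
    rfl

namespace IsDampedSolution

theorem standardEnergy_sub_eq_of_factor {X : Type*} [NormedAddCommGroup X]
    [InnerProductSpace ℝ X] [CompleteSpace X] (hw : IsDampedSolution B a c w w' z)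
    (L : EnergySpace S →ₗ[ℝ] X) (hLw : ContinuousOn (fun s => L (w s)) (Icc a c))
    {Λ : ℝ → X →L[ℝ] U} (hΛ : MemLp Λ ⊤ (volume.restrict (Ioo a c)))
    (hBΛ : ∀ s ∈ Ioo a c, ∀ φ, dualAdjoint (B s) φ = Λ s (L φ)) {Y : ℝ → X}
    (hY : MemLp Y 2 (volume.restrict (Ioo a c)))
    (hLY : TendstoL2Shrinking a c (fun h => diffQuot h fun s => L (w s)) Y) (he : e ∈ Icc a c) :
    standardEnergy (w e) (w' e) - standardEnergy (w a) (w' a) = -∫ s in a..e, ‖z s‖ ^ 2 := by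
  obtain ⟨hz, hsol⟩ := hw
  have hΛz : TendstoL2Shrinking a c (fun h s => Λ s (diffQuot h (fun r => L (w r)) s)) z := by
    refine hz.tendstoL2Shrinking.congr (fun h hh s hs => ?_) fun _ _ => rfl
    rw [hBΛ s ⟨hs.1, hs.2.trans (sub_lt_self c hh)⟩, map_diffQuot]
  have hmeas : ∀ᶠ h in 𝓝[>] 0, AEStronglyMeasurable
      (fun s => Λ s (diffQuot h (fun r => L (w r)) s)) (volume.restrict (Ioo a (c - h))) := by
    filter_upwards [self_mem_nhdsWithin] with h (hh : 0 < h)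
    exact isBoundedBilinearMap_apply.continuous.comp_aestronglyMeasurable
      ((hΛ.1.mono_measure (Measure.restrict_mono_set _ (Ioo_subset_Ioo_right
        (sub_le_self c hh.le)))).prodMk (aestronglyMeasurable_diffQuot hLw hh.le))
  have hzY : (fun s => Λ s (Y s)) =ᵐ[volume.restrict (Ioo a c)] z :=
    (hLY.clm_apply hΛ).ae_unique hΛz hmeas (memLp_clm_apply hΛ hY) hz.1
  rw [hsol.standardEnergy_sub_eq L hLw (memLp_clm_apply (memLp_adjoint hΛ) hz.1) hY hLY
    (fun φ s hs => ?_) he]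
  · rw [intervalIntegral.integral_of_le he.1, intervalIntegral.integral_of_le he.1,
      integral_Ioc_eq_integral_Ioo, integral_Ioc_eq_integral_Ioo]
    congr 1
    refine integral_congr_ae ?_
    filter_upwards [ae_restrict_of_ae_restrict_of_subset (Ioo_subset_Ioo_right he.2) hzY]
      with s hs
    rw [ContinuousLinearMap.adjoint_inner_left, hs, real_inner_self_eq_norm_sq]
  · rw [hBΛ s hs, inner_zero_left, add_zero, ContinuousLinearMap.adjoint_inner_left]

theorem standardEnergy_sub_eq (hB : BoundedDamping B a c) (hw : IsDampedSolution B a c w w' z)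
    (he : e ∈ Icc a c) :
    standardEnergy (w e) (w' e) - standardEnergy (w a) (w' a) = -∫ s in a..e, ‖z s‖ ^ 2 := by
  rcases hB with ⟨F, hF, hBF⟩ | ⟨r, C, hr, hr_inv, hBC⟩
  · exact hw.standardEnergy_sub_eq_of_factor (EnergySpace.toH S) hw.2.continuousOn_toH
      (memLp_adjoint hF) (fun s hs => dualAdjoint_eq_adjoint (hBF s hs))
      (memLp_of_continuousOn_Icc hw.2.continuousOn_deriv 2)
      (tendstoL2Shrinking_diffQuot hw.2.hasDeriv hw.2.continuousOn_deriv) he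
  · have hscalar : ∀ {ρ : ℝ → ℝ}, MemLp ρ ⊤ (volume.restrict (Ioo a c)) →
        MemLp (fun s => ρ s • ContinuousLinearMap.id ℝ U) ⊤ (volume.restrict (Ioo a c)) :=
      fun hρ => (memLp_top_const (ContinuousLinearMap.id ℝ U)).smul hρ
    have hCz : TendstoL2Shrinking a c (fun h => diffQuot h fun s => dualAdjointCLM C (w s))
        fun s => (r s)⁻¹ • z s := by
      refine (hw.1.tendstoL2Shrinking.clm_apply (hscalar hr_inv)).congr (fun h hh s hs => ?_)
        fun _ _ => rfl
      obtain ⟨hrs, hBs⟩ := hBC s ⟨hs.1, hs.2.trans (sub_lt_self c hh)⟩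
      simp only [hBs, dualAdjoint_smul_left, Pi.inv_apply, smul_apply,
        ContinuousLinearMap.id_apply, inv_smul_smul₀ hrs]
      exact map_diffQuot (dualAdjointCLM C).toLinearMap h w s
    exact hw.standardEnergy_sub_eq_of_factor (dualAdjointCLM C).toLinearMap
      ((dualAdjointCLM C).continuous.comp_continuousOn hw.2.continuousOn) (hscalar hr)
      (fun s hs φ => by
        rw [(hBC s hs).2, dualAdjoint_smul_left, ← dualAdjointCLM_apply, smul_apply,
          ContinuousLinearMap.id_apply, ContinuousLinearMap.coe_coe])
      (memLp_clm_apply (hscalar hr_inv) hw.1.1) hCz he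

theorem standardEnergy_le (hB : BoundedDamping B a c) (hw : IsDampedSolution B a c w w' z)
    (he : e ∈ Icc a c) : standardEnergy (w e) (w' e) ≤ standardEnergy (w a) (w' a) := by
  have hnonneg : 0 ≤ ∫ s in a..e, ‖z s‖ ^ 2 :=
    intervalIntegral.integral_nonneg he.1 fun s _ => sq_nonneg _
  linarith [hw.standardEnergy_sub_eq hB he]

theorem standardEnergy_le_of_observability (hB : BoundedDamping B a c)
    (hw : IsDampedSolution B a c w w' z) (hac : a ≤ c) {δ : ℝ} (hδ : 0 < δ)
    (hobs : standardEnergy (w c) (w' c) ≤ δ * ∫ s in a..c, ‖z s‖ ^ 2) :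
    standardEnergy (w c) (w' c) ≤ δ / (δ + 1) * standardEnergy (w a) (w' a) := by
  have hbalance := hw.standardEnergy_sub_eq hB (right_mem_Icc.2 hac)
  rw [div_mul_eq_mul_div, le_div_iff₀ (by linarith)]
  linear_combination hobs + δ * hbalance

end IsDampedSolution

end Damping

section Switching

theorem exists_le_of_le_one_add_mul {x ε : ℕ → ℝ} (hx : ∀ n, 0 ≤ x n) (hε : ∀ n, 0 ≤ ε n)
    (hsum : Summable ε) (hrec : ∀ n, x (n + 1) ≤ (1 + ε n) * x n) : ∃ K, ∀ n, x n ≤ K := by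
  refine ⟨x 0 * Real.exp (∑' n, ε n), fun n => ?_⟩
  have hgronwall := discrete_gronwall (b := fun _ => 0) (hx 0)
    (fun n _ => (hrec n).trans_eq (add_zero _).symm) (fun n _ => hε n) (fun _ _ => le_rfl)
    (Nat.zero_le n)
  rw [Finset.sum_const_zero, add_zero] at hgronwall
  refine hgronwall.trans (mul_le_mul_of_nonneg_left (Real.exp_le_exp.2 ?_) (hx 0))
  exact hsum.sum_le_tsum _ fun n _ => hε n

theorem le_mul_prod_add_sum_of_le_mul_add {x q η : ℕ → ℝ} (hq : ∀ n, 0 ≤ q n)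
    (hq1 : ∀ n, q n ≤ 1) (hη : ∀ n, 0 ≤ η n) (hrec : ∀ n, x (n + 1) ≤ q n * x n + η n)
    {k N : ℕ} (hkN : k ≤ N) :
    x N ≤ x k * ∏ n ∈ Finset.Ico k N, q n + ∑ n ∈ Finset.Ico k N, η n := by
  refine (discrete_gronwall_prod_general (fun n _ => hrec n) (fun n _ => hq n) hkN).trans ?_
  gcongr with n
  exact mul_le_of_le_one_right (hη n) (Finset.prod_le_one (fun i _ => hq i) fun i _ => hq1 i)

theorem tendsto_prod_Ico_zero {q : ℕ → ℝ} (hq : ∀ n, q n ≠ 0)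
    (hprod : Tendsto (fun N => ∏ n ∈ Finset.range N, q n) atTop (𝓝 0)) (k : ℕ) :
    Tendsto (fun N => ∏ n ∈ Finset.Ico k N, q n) atTop (𝓝 0) := by
  have hdiv := hprod.div_const (∏ n ∈ Finset.range k, q n)
  rw [zero_div] at hdiv
  refine hdiv.congr' ?_
  filter_upwards [eventually_ge_atTop k] with N hN
  rw [← Finset.prod_range_mul_prod_Ico q hN,
    mul_div_cancel_left₀ _ (Finset.prod_ne_zero_iff.2 fun n _ => hq n)]

theorem tendsto_zero_of_le_mul_add {x q η : ℕ → ℝ} (hx : ∀ n, 0 ≤ x n) (hq : ∀ n, 0 < q n)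
    (hq1 : ∀ n, q n ≤ 1) (hη : ∀ n, 0 ≤ η n) (hsum : Summable η)
    (hprod : Tendsto (fun N => ∏ n ∈ Finset.range N, q n) atTop (𝓝 0))
    (hrec : ∀ n, x (n + 1) ≤ q n * x n + η n) : Tendsto x atTop (𝓝 0) := by
  refine tendsto_order.2 ⟨fun ρ hρ => Eventually.of_forall fun n => hρ.trans_le (hx n),
    fun ρ hρ => ?_⟩
  obtain ⟨k, hk⟩ := ((tendsto_sum_nat_add η).eventually_lt_const (half_pos hρ)).exists
  have hhead := (tendsto_prod_Ico_zero (fun n => (hq n).ne') hprod k).const_mul (x k)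
  rw [mul_zero] at hhead
  filter_upwards [hhead.eventually_lt_const (half_pos hρ), eventually_ge_atTop k] with N hN hkN
  have htail : ∑ n ∈ Finset.Ico k N, η n ≤ ∑' n, η (n + k) := by
    simp only [Finset.sum_Ico_eq_sum_range, add_comm k]
    exact ((summable_nat_add_iff k).2 hsum).sum_le_tsum _ fun n _ => hη _
  linarith [le_mul_prod_add_sum_of_le_mul_add (fun n => (hq n).le) hq1 hη hrec hkN]

theorem tendsto_zero_of_le_add_mul {x q ε : ℕ → ℝ} (hx : ∀ n, 0 ≤ x n) (hq : ∀ n, 0 < q n)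
    (hq1 : ∀ n, q n ≤ 1) (hε : ∀ n, 0 ≤ ε n) (hsum : Summable ε)
    (hprod : Tendsto (fun N => ∏ n ∈ Finset.range N, q n) atTop (𝓝 0))
    (hrec : ∀ n, x (n + 1) ≤ (q n + ε n) * x n) : Tendsto x atTop (𝓝 0) := by
  obtain ⟨K, hK⟩ := exists_le_of_le_one_add_mul hx hε hsum fun n => (hrec n).trans
    (mul_le_mul_of_nonneg_right (add_le_add_left (hq1 n) _) (hx n))
  refine tendsto_zero_of_le_mul_add hx hq hq1 (fun n => mul_nonneg (hε n) ((hx 0).trans (hK 0)))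
    (hsum.mul_right K) hprod fun n => (hrec n).trans ?_
  rw [add_mul]
  gcongr
  exacts [hε n, hK n]

theorem tendsto_prod_sqrt_of_sum_log_atBot {r : ℕ → ℝ} (hr : ∀ n, 0 < r n)
    (h : Tendsto (fun N => ∑ n ∈ Finset.range N, Real.log (r n)) atTop atBot) :
    Tendsto (fun N => ∏ n ∈ Finset.range N, √(r n)) atTop (𝓝 0) := by
  have hsqrt := (Real.tendsto_exp_atBot.comp h).sqrt
  rw [Real.sqrt_zero] at hsqrt
  refine hsqrt.congr fun N => ?_
  rw [Function.comp, Real.exp_sum, Real.sqrt_prod _ fun n _ => (Real.exp_pos _).le]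
  exact Finset.prod_congr rfl fun n _ => by rw [Real.exp_log (hr n)]

theorem tendsto_zero_of_le_on_intervals {t : ℕ → ℝ} (ht : Monotone t)
    (htop : Tendsto t atTop atTop) {g : ℝ → ℝ} {y : ℕ → ℝ} (hg : ∀ s, 0 ≤ g s)
    (hle : ∀ n, ∀ s ∈ Icc (t n) (t (n + 1)), g s ≤ y n) (hy : Tendsto y atTop (𝓝 0)) :
    Tendsto g atTop (𝓝 0) := by
  refine tendsto_order.2 ⟨fun ρ hρ => Eventually.of_forall fun s => hρ.trans_le (hg s),
    fun ρ hρ => ?_⟩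
  obtain ⟨N, hN⟩ := eventually_atTop.1 (hy.eventually_lt_const hρ)
  have hunbdd : ¬BddAbove (t '' Ici N) := fun ⟨b, hb⟩ =>
    have ⟨n, hbn, hNn⟩ := ((htop.eventually_gt_atTop b).and (eventually_ge_atTop N)).exists
    hbn.not_ge (hb ⟨n, hNn, rfl⟩)
  have hcover : ⋃ n ∈ Ici N, Ico (t n) (t (Order.succ n)) = Ici (t N) :=
    biUnion_Ici_Ico_map_succ (fun n hn => ht hn) hunbdd
  filter_upwards [eventually_ge_atTop (t N)] with s hs
  obtain ⟨n, hn, hsn⟩ := mem_iUnion₂.1 (hcover.superset hs)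
  exact (hle n s (Ico_subset_Icc_self hsn)).trans_lt (hN n hn)

theorem tendsto_atTop_of_le_gap_even {t : ℕ → ℝ} (ht : Monotone t) {τ : ℝ} (hτ : 0 < τ)
    (hgap : ∀ n, τ ≤ t (2 * n + 1) - t (2 * n)) : Tendsto (fun n => t (2 * n)) atTop atTop := by
  have hge : ∀ n : ℕ, t 0 + n * τ ≤ t (2 * n) := by
    intro n
    induction n with
    | zero => simp
    | succ n ih =>
      have hmono : t (2 * n + 1) ≤ t (2 * (n + 1)) := ht (Nat.le_succ _)
      push_cast
      linarith [hgap n]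
  exact tendsto_atTop_mono hge (tendsto_atTop_add_const_left _ _
    (tendsto_natCast_atTop_atTop.atTop_mul_const hτ))

theorem tendsto_zero_of_switching {t : ℕ → ℝ} (ht : Monotone t)
    (htop : Tendsto (fun n => t (2 * n)) atTop atTop) {g : ℝ → ℝ} (hg : ∀ s, 0 ≤ g s)
    {q ε : ℕ → ℝ} (hq : ∀ n, 0 < q n) (hq1 : ∀ n, q n ≤ 1) (hε : ∀ n, 0 ≤ ε n)
    (hsum : Summable ε) (hprod : Tendsto (fun N => ∏ n ∈ Finset.range N, q n) atTop (𝓝 0))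
    (heven : ∀ n, ∀ s ∈ Icc (t (2 * n)) (t (2 * n + 1)), g s ≤ g (t (2 * n)))
    (hcontr : ∀ n, g (t (2 * n + 1)) ≤ q n * g (t (2 * n)))
    (hodd : ∀ n, ∀ s ∈ Icc (t (2 * n + 1)) (t (2 * n + 2)),
      g s ≤ g (t (2 * n + 1)) + ε n * g (t (2 * n))) :
    Tendsto g atTop (𝓝 0) := by
  have hrec : ∀ n, ∀ s ∈ Icc (t (2 * n + 1)) (t (2 * n + 2)),
      g s ≤ (q n + ε n) * g (t (2 * n)) := fun n s hs => by
    linarith [hodd n s hs, hcontr n]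
  have hlim : Tendsto (fun n => g (t (2 * n))) atTop (𝓝 0) :=
    tendsto_zero_of_le_add_mul (fun n => hg _) hq hq1 hε hsum hprod fun n =>
      hrec n _ (right_mem_Icc.2 (ht (Nat.le_succ _)))
  have hbound := (hsum.tendsto_atTop_zero.const_add 1).mul hlim
  rw [mul_zero] at hbound
  refine tendsto_zero_of_le_on_intervals
    (ht.comp fun _ _ hmn => Nat.mul_le_mul_left 2 hmn) htop hg (fun n s hs => ?_) hbound
  rcases le_total s (t (2 * n + 1)) with hs₁ | hs₁
  · exact (heven n s ⟨hs.1, hs₁⟩).trans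
      (le_mul_of_one_le_left (hg _) (le_add_of_nonneg_right (hε n)))
  · exact (hrec n s ⟨hs₁, hs.2⟩).trans
      (mul_le_mul_of_nonneg_right (add_le_add_left (hq1 n) _) (hg _))

theorem tendsto_zero_of_switching_sqrt {t : ℕ → ℝ} (ht : Monotone t)
    (htop : Tendsto (fun n => t (2 * n)) atTop atTop) {E : ℝ → ℝ} (hE : ∀ s, 0 ≤ E s)
    {r ε : ℕ → ℝ} (hr : ∀ n, 0 < r n) (hr1 : ∀ n, r n ≤ 1) (hε : ∀ n, 0 ≤ ε n)
    (hsum : Summable ε)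
    (hlog : Tendsto (fun N => ∑ n ∈ Finset.range N, Real.log (r n)) atTop atBot)
    (heven : ∀ n, ∀ s ∈ Icc (t (2 * n)) (t (2 * n + 1)), E s ≤ E (t (2 * n)))
    (hcontr : ∀ n, E (t (2 * n + 1)) ≤ r n * E (t (2 * n)))
    (hodd : ∀ n, ∀ s ∈ Icc (t (2 * n + 1)) (t (2 * n + 2)),
      √(E s) ≤ √(E (t (2 * n + 1))) + ε n * √(E (t (2 * n)))) :
    Tendsto E atTop (𝓝 0) := by
  have hroot : Tendsto (fun s => √(E s)) atTop (𝓝 0) :=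
    tendsto_zero_of_switching ht htop (fun _ => Real.sqrt_nonneg _)
      (fun n => Real.sqrt_pos.2 (hr n)) (fun n => Real.sqrt_le_one.2 (hr1 n)) hε hsum
      (tendsto_prod_sqrt_of_sum_log_atBot hr hlog)
      (fun n s hs => Real.sqrt_le_sqrt (heven n s hs))
      (fun n => (Real.sqrt_le_sqrt (hcontr n)).trans_eq (Real.sqrt_mul (hr n).le _)) hodd
  simpa [Real.sq_sqrt (hE _)] using hroot.pow 2

end Switching

section Restriction

theorem integrable_inner_of_memLp_two {α E : Type*} [MeasurableSpace α] {μ : Measure α}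
    [NormedAddCommGroup E] [InnerProductSpace ℝ E] {f g : α → E}
    (hf : MemLp f 2 μ) (hg : MemLp g 2 μ) : Integrable (fun x => inner ℝ (f x) (g x)) μ :=
  (hf.norm.integrable_mul hg.norm).mono' (hf.1.inner hg.1)
    (Eventually.of_forall fun _ => norm_inner_le_norm _ _)

variable {H : Type*} [NormedAddCommGroup H] [InnerProductSpace ℝ H]
  {U : Type*} [NormedAddCommGroup U] [InnerProductSpace ℝ U] [CompleteSpace U]
  {S : H →ₗ.[ℝ] H} {B : ℝ → U →L[ℝ] StrongDual ℝ (EnergySpace S)} {f : ℝ → H} {o a c : ℝ}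
  {w : ℝ → EnergySpace S} {w' : ℝ → H} {z : ℝ → U}

theorem intervalIntegrable_weak_integrand (hac : a ≤ c) (hw : ContinuousOn w (Icc a c))
    (hz : MemLp z 2 (volume.restrict (Ioo a c))) {φ : EnergySpace S}
    (hB : MemLp (fun s => dualAdjoint (B s) φ) 2 (volume.restrict (Ioo a c)))
    (hf : MemLp f 2 (volume.restrict (Ioo a c))) :
    IntervalIntegrable (fun r => inner ℝ (w r) φ + inner ℝ (z r) (dualAdjoint (B r) φ) +
      inner ℝ (f r) (EnergySpace.toH S φ)) volume a c := by
  rw [intervalIntegrable_iff_integrableOn_Ioo_of_le hac]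
  have hsqrt := memLp_of_continuousOn_Icc
    ((EnergySpace.continuous_sqrtMap S).comp_continuousOn hw) 2
  exact ((integrable_inner_of_memLp_two hsqrt (memLp_const (EnergySpace.sqrtMap S φ))).add
    (integrable_inner_of_memLp_two hz hB)).add (integrable_inner_of_memLp_two hf (memLp_const _))

namespace IsWeakSolution

theorem congr_force {g : ℝ → H} (hw : IsWeakSolution B f a (Icc a c) w w' z)
    (hfg : ∀ s ∈ Ioo a c, f s = g s) : IsWeakSolution B g a (Icc a c) w w' z where
  __ := hw
  weak_eq φ s hs := by
    rw [← hw.weak_eq φ s hs]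
    congr 1
    exact intervalIntegral_congr_Ioo hs fun r hr => by rw [hfg r hr]

theorem mono_Icc (hw : IsWeakSolution B f o (Ici o) w w' z) (hoa : o ≤ a)
    (hint : ∀ φ, IntervalIntegrable (fun r => inner ℝ (w r) φ +
      inner ℝ (z r) (dualAdjoint (B r) φ) + inner ℝ (f r) (EnergySpace.toH S φ)) volume o c) :
    IsWeakSolution B f a (Icc a c) w w' z where
  continuousOn := hw.continuousOn.mono (Icc_subset_Ici_self.trans (Ici_subset_Ici.2 hoa))
  continuousOn_deriv := hw.continuousOn_deriv.mono
    (Icc_subset_Ici_self.trans (Ici_subset_Ici.2 hoa))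
  hasDeriv s hs := (hw.hasDeriv s (hoa.trans hs.1)).mono
    (Icc_subset_Ici_self.trans (Ici_subset_Ici.2 hoa))
  weak_eq φ s hs := by
    have hos := hoa.trans hs.1
    have hsub : ∀ {x y}, x ∈ Icc o s → y ∈ Icc o s → uIcc x y ⊆ uIcc o c := fun hx hy =>
      (uIcc_subset_Icc hx hy).trans ((Icc_subset_Icc_right hs.2).trans Icc_subset_uIcc)
    have hadd := intervalIntegral.integral_add_adjacent_intervals
      ((hint φ).mono_set (hsub (left_mem_Icc.2 hos) ⟨hoa, hs.1⟩))
      ((hint φ).mono_set (hsub ⟨hoa, hs.1⟩ (right_mem_Icc.2 hos)))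
    linear_combination hw.weak_eq φ s hos - hw.weak_eq φ a hoa + hadd

theorem restrict_Icc {t : ℕ → ℝ} (ht : Monotone t)
    (hw : IsWeakSolution B f (t 0) (Ici (t 0)) w w' z)
    (hz : ∀ n, MemLp z 2 (volume.restrict (Ioo (t n) (t (n + 1)))))
    (hB : ∀ n φ, MemLp (fun s => dualAdjoint (B s) φ) 2
      (volume.restrict (Ioo (t n) (t (n + 1)))))
    (hf : ∀ n, MemLp f 2 (volume.restrict (Ioo (t n) (t (n + 1))))) (n : ℕ) :
    IsWeakSolution B f (t n) (Icc (t n) (t (n + 1))) w w' z :=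
  hw.mono_Icc (ht (Nat.zero_le n)) fun φ => IntervalIntegrable.trans_iterate fun k _ =>
    intervalIntegrable_weak_integrand (ht (Nat.le_succ k))
      (hw.continuousOn.mono fun _ hs => (ht (Nat.zero_le k)).trans hs.1) (hz k) (hB k φ) (hf k)

end IsWeakSolution

end Restriction

section DelayedFeedback

variable {H : Type*} [NormedAddCommGroup H] [InnerProductSpace ℝ H]

section Energy

variable {S : H →ₗ.[ℝ] H} (v : EnergySpace S) (v' : H)

theorem standardEnergy_nonneg : 0 ≤ standardEnergy v v' := by
  unfold standardEnergy
  positivity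

theorem norm_le_sqrt_two_mul_sqrt_standardEnergy : ‖v'‖ ≤ √2 * √(standardEnergy v v') := by
  rw [← Real.sqrt_mul zero_le_two, standardEnergy, mul_div_cancel₀ _ two_ne_zero]
  exact Real.le_sqrt_of_sq_le (le_add_of_nonneg_left (sq_nonneg _))

end Energy

theorem le_add_of_sq_le_sq_add_mul {x y D : ℝ} (hy : 0 ≤ y) (hD : 0 ≤ D)
    (h : x ^ 2 ≤ y ^ 2 + D * x) : x ≤ y + D := by
  by_contra! hlt
  nlinarith

variable [CompleteSpace H]
  {U : Type*} [NormedAddCommGroup U] [InnerProductSpace ℝ U] [CompleteSpace U]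

theorem norm_apply_adjoint_le (B : U →L[ℝ] H) (v : H) :
    ‖B (ContinuousLinearMap.adjoint B v)‖ ≤ ‖B‖ ^ 2 * ‖v‖ :=
  calc ‖B (ContinuousLinearMap.adjoint B v)‖
    _ ≤ ‖B‖ * (‖ContinuousLinearMap.adjoint B‖ * ‖v‖) :=
      B.le_opNorm_of_le (ContinuousLinearMap.le_opNorm _ _)
    _ = ‖B‖ ^ 2 * ‖v‖ := by rw [LinearIsometryEquiv.norm_map, sq, mul_assoc]

theorem memLp_delayedFeedback {B : ℝ → U →L[ℝ] H} {a c τ : ℝ} {v : ℝ → H} {p : ENNReal}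
    (hB : MemLp B ⊤ (volume.restrict (Ioo a c))) (hv : ContinuousOn v (Icc (a - τ) (c - τ))) :
    MemLp (fun s => B s (ContinuousLinearMap.adjoint (B s) (v (s - τ)))) p
      (volume.restrict (Ioo a c)) := by
  have hdelay : ContinuousOn (fun s => v (s - τ)) (Icc a c) :=
    hv.comp (by fun_prop) fun s hs => ⟨sub_le_sub_right hs.1 τ, sub_le_sub_right hs.2 τ⟩
  exact memLp_clm_apply hB (memLp_clm_apply (memLp_adjoint hB)
    (memLp_of_continuousOn_Icc hdelay p))

variable {V : Type*} [NormedAddCommGroup V] [InnerProductSpace ℝ V] [CompleteSpace V]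
  {S : H →ₗ.[ℝ] H} {B : ℝ → V →L[ℝ] StrongDual ℝ (EnergySpace S)} {a c s : ℝ}
  {w : ℝ → EnergySpace S} {w' : ℝ → H} {z : ℝ → V}

namespace IsWeakSolution

theorem sqrt_standardEnergy_le {f : ℝ → H} (hw : IsWeakSolution B f a (Icc a c) w w' z)
    (hB : ∀ s ∈ Ioo a c, B s = 0) (hf : MemLp f 2 (volume.restrict (Ioo a c))) {κ : ℝ}
    (hκ : 0 ≤ κ) (hfκ : ∀ s ∈ Ioo a c, ‖f s‖ ≤ κ) (hs : s ∈ Icc a c) :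
    √(standardEnergy (w s) (w' s)) ≤ √(standardEnergy (w a) (w' a)) + √2 * κ * (c - a) := by
  have hcont : ContinuousOn (fun s => standardEnergy (w s) (w' s)) (Icc a c) :=
    ((hw.continuousOn.norm.pow 2).add (hw.continuousOn_deriv.norm.pow 2)).div_const 2
  obtain ⟨e, he, hmax⟩ := isCompact_Icc.exists_isMaxOn ⟨s, hs⟩ hcont
  set x := √(standardEnergy (w e) (w' e)) with hx
  have hbalance := hw.standardEnergy_sub_eq (EnergySpace.toH S) hw.continuousOn_toH hf
    (memLp_of_continuousOn_Icc hw.continuousOn_deriv 2)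
    (tendstoL2Shrinking_diffQuot hw.hasDeriv hw.continuousOn_deriv)
    (fun φ r hr => by simp [hB r hr, dualAdjoint_zero_left]) he
  have hpower : ∀ r ∈ Ioo a c, ‖inner ℝ (f r) (w' r)‖ ≤ κ * (√2 * x) := fun r hr =>
    (norm_inner_le_norm _ _).trans <| mul_le_mul (hfκ r hr)
      ((norm_le_sqrt_two_mul_sqrt_standardEnergy (w r) (w' r)).trans <|
        mul_le_mul_of_nonneg_left (Real.sqrt_le_sqrt (hmax (Ioo_subset_Icc_self hr)))
          (Real.sqrt_nonneg 2)) (norm_nonneg _) hκ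
  have hwork : ‖∫ r in a..e, inner ℝ (f r) (w' r)‖ ≤ κ * (√2 * x) * |e - a| := by
    refine intervalIntegral.norm_integral_le_of_norm_le_const_ae ?_
    filter_upwards [Measure.ae_ne volume c] with r hrc hr
    rw [uIoc_of_le he.1] at hr
    exact hpower r ⟨hr.1, lt_of_le_of_ne (hr.2.trans he.2) hrc⟩
  have hgrowth : x ^ 2 ≤ √(standardEnergy (w a) (w' a)) ^ 2 + √2 * κ * (c - a) * x := by
    rw [hx, Real.sq_sqrt (standardEnergy_nonneg _ _), Real.sq_sqrt (standardEnergy_nonneg _ _),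
      ← hx]
    have hlen : κ * (√2 * x) * |e - a| ≤ κ * (√2 * x) * (c - a) := by
      rw [abs_of_nonneg (sub_nonneg.2 he.1)]
      gcongr
      exact he.2
    linarith [neg_le_abs (∫ r in a..e, inner ℝ (f r) (w' r)), Real.norm_eq_abs
      (∫ r in a..e, inner ℝ (f r) (w' r))]
  have hac : 0 ≤ c - a := sub_nonneg.2 (hs.1.trans hs.2)
  exact (Real.sqrt_le_sqrt (hmax hs)).trans
    (le_add_of_sq_le_sq_add_mul (Real.sqrt_nonneg _) (by positivity) hgrowth)

theorem sqrt_standardEnergy_le_of_delay {B₂ : ℝ → U →L[ℝ] H} {τ β E₀ : ℝ}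
    (hw : IsWeakSolution B (fun s => B₂ s (ContinuousLinearMap.adjoint (B₂ s) (w' (s - τ)))) a
      (Icc a c) w w' z)
    (hB : ∀ s ∈ Ioo a c, B s = 0)
    (hf : MemLp (fun s => B₂ s (ContinuousLinearMap.adjoint (B₂ s) (w' (s - τ)))) 2
      (volume.restrict (Ioo a c)))
    (hβ : 0 ≤ β) (hB₂ : ∀ s ∈ Ioo a c, ‖B₂ s‖ ^ 2 ≤ β)
    (hE₀ : ∀ s ∈ Ioo a c, standardEnergy (w (s - τ)) (w' (s - τ)) ≤ E₀) (hs : s ∈ Icc a c) :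
    √(standardEnergy (w s) (w' s)) ≤
      √(standardEnergy (w a) (w' a)) + 2 * (β * (c - a)) * √E₀ := by
  have hforce : ∀ s ∈ Ioo a c,
      ‖B₂ s (ContinuousLinearMap.adjoint (B₂ s) (w' (s - τ)))‖ ≤ β * (√2 * √E₀) := by
    intro s hs
    refine (norm_apply_adjoint_le _ _).trans (mul_le_mul (hB₂ s hs) ?_ (norm_nonneg _) hβ)
    exact (norm_le_sqrt_two_mul_sqrt_standardEnergy _ _).trans
      (mul_le_mul_of_nonneg_left (Real.sqrt_le_sqrt (hE₀ s hs)) (Real.sqrt_nonneg 2))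
  refine (hw.sqrt_standardEnergy_le hB hf (by positivity) hforce hs).trans_eq ?_
  linear_combination β * √E₀ * (c - a) * Real.mul_self_sqrt zero_le_two

end IsWeakSolution

end DelayedFeedback

theorem memLp_of_eq_zero_on_Ioo {E : Type*} [NormedAddCommGroup E] {f : ℝ → E} {a c : ℝ}
    (hf : ∀ s ∈ Ioo a c, f s = 0) (p : ENNReal) : MemLp f p (volume.restrict (Ioo a c)) :=
  (memLp_congr_ae ((ae_restrict_mem measurableSet_Ioo).mono hf)).2 MemLp.zero

theorem aestronglyMeasurable_of_eq_continuousOn {E : Type*} [NormedAddCommGroup E]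
    {f F : ℝ → E} {a c : ℝ} (hF : ContinuousOn F (Icc a c)) (hfF : ∀ s ∈ Ioo a c, f s = F s) :
    AEStronglyMeasurable f (volume.restrict (Ioo a c)) :=
  (memLp_of_continuousOn_Icc hF ⊤).1.congr
    ((ae_restrict_mem measurableSet_Ioo).mono fun s hs => (hfF s hs).symm)

theorem norm_sq_le_of_norm_adjoint_sq_le {H U W : Type*}
    [NormedAddCommGroup H] [InnerProductSpace ℝ H] [CompleteSpace H]
    [NormedAddCommGroup U] [InnerProductSpace ℝ U] [CompleteSpace U]
    [SeminormedAddCommGroup W] [NormedSpace ℝ W] {B : U →L[ℝ] H} (j : H →L[ℝ] W) {M : ℝ}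
    (hM : 0 ≤ M) (hB : ∀ v, ‖ContinuousLinearMap.adjoint B v‖ ^ 2 ≤ M * ‖j v‖ ^ 2) :
    ‖B‖ ^ 2 ≤ M * ‖j‖ ^ 2 := by
  have hnorm : ‖ContinuousLinearMap.adjoint B‖ ≤ √M * ‖j‖ := by
    refine ContinuousLinearMap.opNorm_le_bound _ (by positivity) fun v => ?_
    calc ‖ContinuousLinearMap.adjoint B v‖
      _ ≤ √(M * ‖j v‖ ^ 2) := Real.le_sqrt_of_sq_le (hB v)
      _ = √M * ‖j v‖ := by rw [Real.sqrt_mul hM, Real.sqrt_sq (norm_nonneg _)]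
      _ ≤ √M * ‖j‖ * ‖v‖ := by
        rw [mul_assoc]
        gcongr
        exact j.le_opNorm v
  rw [LinearIsometryEquiv.norm_map] at hnorm
  calc ‖B‖ ^ 2
    _ ≤ (√M * ‖j‖) ^ 2 := by gcongr
    _ = M * ‖j‖ ^ 2 := by rw [mul_pow, Real.sq_sqrt hM]

section DelaySolution

variable {H : Type*} [NormedAddCommGroup H] [InnerProductSpace ℝ H] [CompleteSpace H]
  {U₁ : Type*} [NormedAddCommGroup U₁] [InnerProductSpace ℝ U₁] [CompleteSpace U₁]
  {U₂ : Type*} [NormedAddCommGroup U₂] [InnerProductSpace ℝ U₂] [CompleteSpace U₂]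
  {S : H →ₗ.[ℝ] H} {τ : ℝ} {t : ℕ → ℝ}
  {B₁ : ℝ → U₁ →L[ℝ] StrongDual ℝ (EnergySpace S)} {B₂ : ℝ → U₂ →L[ℝ] H}
  {u : ℝ → EnergySpace S} {u' : ℝ → H} {z : ℝ → U₁}

theorem sub_mem_Icc_even (hT_even : ∀ n, τ ≤ t (2 * n + 1) - t (2 * n))
    (hT_odd : ∀ n, t (2 * n + 2) - t (2 * n + 1) ≤ τ) {n : ℕ} {s : ℝ}
    (hs : s ∈ Icc (t (2 * n + 1)) (t (2 * n + 2))) :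
    s - τ ∈ Icc (t (2 * n)) (t (2 * n + 1)) :=
  ⟨by linarith [hs.1, hT_even n], by linarith [hs.2, hT_odd n]⟩

namespace IsDelaySolution

theorem memLp_delayedFeedback_odd (hu : IsDelaySolution B₁ B₂ τ t u u' z) (ht0 : t 0 = 0)
    (ht : Monotone t) (hT_even : ∀ n, τ ≤ t (2 * n + 1) - t (2 * n)) {n : ℕ}
    (hB₂ : MemLp B₂ ⊤ (volume.restrict (Ioo (t (2 * n + 1)) (t (2 * n + 2))))) :
    MemLp (fun s => B₂ s (ContinuousLinearMap.adjoint (B₂ s) (u' (s - τ)))) 2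
      (volume.restrict (Ioo (t (2 * n + 1)) (t (2 * n + 2)))) := by
  refine memLp_delayedFeedback hB₂ (hu.2.continuousOn_deriv.mono fun s hs => ?_)
  have htn : 0 ≤ t (2 * n) := ht0 ▸ ht (Nat.zero_le _)
  exact htn.trans (le_trans (by linarith [hT_even n]) hs.1)

theorem isWeakSolution_Icc (hu : IsDelaySolution B₁ B₂ τ t u u' z) (ht0 : t 0 = 0)
    (ht : Monotone t) (hT_even : ∀ n, τ ≤ t (2 * n + 1) - t (2 * n))
    (hB₁ : ∀ n, BoundedDamping B₁ (t n) (t (n + 1)))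
    (hB₂_even : ∀ n, ∀ s ∈ Ioo (t (2 * n)) (t (2 * n + 1)), B₂ s = 0)
    (hB₂_odd : ∀ n, MemLp B₂ ⊤ (volume.restrict (Ioo (t (2 * n + 1)) (t (2 * n + 2))))) (n : ℕ) :
    IsWeakSolution B₁ (fun s => B₂ s (ContinuousLinearMap.adjoint (B₂ s) (u' (s - τ)))) (t n)
      (Icc (t n) (t (n + 1))) u u' z := by
  have hsol := hu.2
  rw [← ht0] at hsol
  refine hsol.restrict_Icc ht (fun n => (hu.1 n).1) (fun n => (hB₁ n).memLp_dualAdjoint)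
    (fun n => ?_) n
  obtain ⟨k, rfl | rfl⟩ := n.even_or_odd'
  · exact memLp_of_eq_zero_on_Ioo (fun s hs => by rw [hB₂_even k s hs, zero_apply]) 2
  · exact hu.memLp_delayedFeedback_odd ht0 ht hT_even (hB₂_odd k)

end IsDelaySolution

end DelaySolution

theorem theorem4p3_general
    {H : Type*} [NormedAddCommGroup H] [InnerProductSpace ℝ H] [CompleteSpace H]
    {U₁ : Type*} [NormedAddCommGroup U₁] [InnerProductSpace ℝ U₁] [CompleteSpace U₁]
    {U₂ : Type*} [NormedAddCommGroup U₂] [InnerProductSpace ℝ U₂] [CompleteSpace U₂]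
    {S : H →ₗ.[ℝ] H} {τ : ℝ} (hτ : 0 < τ) {t : ℕ → ℝ} (ht0 : t 0 = 0) (ht : ∀ n, t n < t (n + 1))
    (hT_even : ∀ n, τ ≤ t (2 * n + 1) - t (2 * n))
    (hT_odd : ∀ n, t (2 * n + 2) - t (2 * n + 1) ≤ τ)
    {B₁ : ℝ → U₁ →L[ℝ] StrongDual ℝ (EnergySpace S)} {B₂ : ℝ → U₂ →L[ℝ] H}
    (hB₂_zero : ∀ n, ∀ s ∈ Ico (t (2 * n)) (t (2 * n + 1)), B₂ s = 0)
    (hB₁_zero : ∀ n, ∀ s ∈ Ico (t (2 * n + 1)) (t (2 * n + 2)), B₁ s = 0)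
    (hB₂_meas : ∀ n,
      AEStronglyMeasurable B₂ (volume.restrict (Ioo (t (2 * n + 1)) (t (2 * n + 2)))))
    (hB₁_even : ∀ n, BoundedDamping B₁ (t (2 * n)) (t (2 * n + 1)))
    {β : ℕ → ℝ} (hB₂_le : ∀ n, ∀ s ∈ Ico (t (2 * n + 1)) (t (2 * n + 2)), ‖B₂ s‖ ^ 2 ≤ β n)
    {δ : ℕ → ℝ} (hδ : ∀ n, 0 < δ n)
    (hobs : ∀ n (w : ℝ → EnergySpace S) (w' : ℝ → H) (z : ℝ → U₁),
      IsDampedSolution B₁ (t (2 * n)) (t (2 * n + 1)) w w' z →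
      standardEnergy (w (t (2 * n + 1))) (w' (t (2 * n + 1))) ≤
        δ n * ∫ s in t (2 * n)..t (2 * n + 1), ‖z s‖ ^ 2)
    (hsum : Summable fun n => β n * (t (2 * n + 2) - t (2 * n + 1)))
    (hlog : Tendsto (fun N => ∑ n ∈ Finset.range N, Real.log (δ n / (δ n + 1))) atTop atBot)
    {u : ℝ → EnergySpace S} {u' : ℝ → H} {z : ℝ → U₁}
    (hu : IsDelaySolution B₁ B₂ τ t u u' z) :
    Tendsto (fun s => standardEnergy (u s) (u' s)) atTop (𝓝 0) := by
  have hmono : Monotone t := monotone_nat_of_le_succ fun n => (ht n).le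
  have hβ : ∀ n, 0 ≤ β n := fun n =>
    (sq_nonneg _).trans (hB₂_le n _ (left_mem_Ico.2 (ht (2 * n + 1))))
  have hB₁_odd : ∀ n, ∀ s ∈ Ioo (t (2 * n + 1)) (t (2 * n + 2)), B₁ s = 0 :=
    fun n s hs => hB₁_zero n s (Ioo_subset_Ico_self hs)
  have hB₁ : ∀ n, BoundedDamping B₁ (t n) (t (n + 1)) := fun n => by
    obtain ⟨k, rfl | rfl⟩ := n.even_or_odd'
    exacts [hB₁_even k, boundedDamping_of_eq_zero (hB₁_odd k)]
  have hB₂_odd : ∀ n, MemLp B₂ ⊤ (volume.restrict (Ioo (t (2 * n + 1)) (t (2 * n + 2)))) :=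
    fun n => memLp_top_of_bound (hB₂_meas n) √(β n) <|
      (ae_restrict_mem measurableSet_Ioo).mono fun s hs =>
        Real.le_sqrt_of_sq_le (hB₂_le n s (Ioo_subset_Ico_self hs))
  have hB₂_even : ∀ n, ∀ s ∈ Ioo (t (2 * n)) (t (2 * n + 1)), B₂ s = 0 :=
    fun n s hs => hB₂_zero n s (Ioo_subset_Ico_self hs)
  have hsol := hu.isWeakSolution_Icc ht0 hmono hT_even hB₁ hB₂_even hB₂_odd
  have hdamped : ∀ n, IsDampedSolution B₁ (t (2 * n)) (t (2 * n + 1)) u u' z := fun n =>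
    ⟨hu.1 _, (hsol _).congr_force fun s hs => by rw [hB₂_even n s hs, zero_apply]⟩
  have hdecay : ∀ n, ∀ s ∈ Icc (t (2 * n)) (t (2 * n + 1)),
      standardEnergy (u s) (u' s) ≤ standardEnergy (u (t (2 * n))) (u' (t (2 * n))) :=
    fun n s hs => (hdamped n).standardEnergy_le (hB₁_even n) hs
  refine tendsto_zero_of_switching_sqrt hmono (tendsto_atTop_of_le_gap_even hmono hτ hT_even)
    (fun _ => standardEnergy_nonneg _ _) (fun n => div_pos (hδ n) (by linarith [hδ n]))
    (fun n => (div_le_one (by linarith [hδ n])).2 (by linarith))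
    (fun n => mul_nonneg zero_le_two (mul_nonneg (hβ n) (sub_nonneg.2 (ht _).le)))
    (hsum.mul_left 2) hlog hdecay (fun n => ?_) (fun n s hs => ?_)
  · exact (hdamped n).standardEnergy_le_of_observability (hB₁_even n) (ht _).le (hδ n)
      (hobs n u u' z (hdamped n))
  · exact (hsol (2 * n + 1)).sqrt_standardEnergy_le_of_delay (hB₁_odd n)
      (hu.memLp_delayedFeedback_odd ht0 hmono hT_even (hB₂_odd n)) (hβ n)
      (fun r hr => hB₂_le n r (Ioo_subset_Ico_self hr))
      (fun r hr => hdecay n _ (sub_mem_Icc_even hT_even hT_odd (Ioo_subset_Icc_self hr))) hs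

theorem theorem4p3
    {H : Type*} [NormedAddCommGroup H] [InnerProductSpace ℝ H] [CompleteSpace H]
    {U₁ : Type*} [NormedAddCommGroup U₁] [InnerProductSpace ℝ U₁] [CompleteSpace U₁]
    {U₂ : Type*} [NormedAddCommGroup U₂] [InnerProductSpace ℝ U₂] [CompleteSpace U₂]
    {W : Type*} [NormedAddCommGroup W] [InnerProductSpace ℝ W] [CompleteSpace W]
    -- the operator `A` and its square root `S = A^{1/2}`; `V = D(A^{1/2})` is `EnergySpace S`
    (A S : H →ₗ.[ℝ] H) (hA : IsPosSelfAdjointCompactInverse A) (hS : IsPosSqrt S A)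
    -- the delay and the switching times
    (τ : ℝ) (hτ : 0 < τ) (t : ℕ → ℝ) (ht0 : t 0 = 0) (ht : ∀ n, t n < t (n + 1))
    (hT_even : ∀ n, τ ≤ t (2 * n + 1) - t (2 * n))
    (hT_odd : ∀ n, t (2 * n + 2) - t (2 * n + 1) ≤ τ)
    -- the feedback operators
    (B₁ : ℝ → U₁ →L[ℝ] StrongDual ℝ (EnergySpace S)) (B₂ : ℝ → U₂ →L[ℝ] H)
    (hB₂_zero : ∀ n, ∀ s ∈ Ico (t (2 * n)) (t (2 * n + 1)), B₂ s = 0)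
    (hB₁_zero : ∀ n, ∀ s ∈ Ico (t (2 * n + 1)) (t (2 * n + 2)), B₁ s = 0)
    (hB₂_cont : ∀ n, ∃ F : ℝ → U₂ →L[ℝ] H,
      ContinuousOn F (Icc (t (2 * n + 1)) (t (2 * n + 2))) ∧
      ∀ s ∈ Ico (t (2 * n + 1)) (t (2 * n + 2)), B₂ s = F s)
    (hB₁_adm : ∀ n, AdmissibleDamping B₁ (t (2 * n)) (t (2 * n + 1)))
    -- the maps `V → U₁` and `H → W`, and the bounds i), ii)
    (jU : EnergySpace S →L[ℝ] U₁) (jW : H →L[ℝ] W) (m M : ℕ → ℝ)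
    (hm : ∀ n, 0 < m (2 * n)) (hmM : ∀ n, m (2 * n) ≤ M (2 * n))
    (hM : ∀ n, 0 < M (2 * n + 1))
    (h_i : ∀ n, ∀ s ∈ Ico (t (2 * n)) (t (2 * n + 1)), ∀ v : EnergySpace S,
      m (2 * n) * ‖jU v‖ ^ 2 ≤ ‖dualAdjoint (B₁ s) v‖ ^ 2 ∧
      ‖dualAdjoint (B₁ s) v‖ ^ 2 ≤ M (2 * n) * ‖jU v‖ ^ 2)
    (h_ii : ∀ n, ∀ s ∈ Ico (t (2 * n + 1)) (t (2 * n + 2)), ∀ v : H,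
      ‖ContinuousLinearMap.adjoint (B₂ s) v‖ ^ 2 ≤ M (2 * n + 1) * ‖jW v‖ ^ 2)
    -- the observability type inequality, with constant `d n T` for the time `T`
    (Tbar : ℕ → ℝ) (hTbar_nonneg : ∀ n, 0 ≤ Tbar n)
    (hTbar : ∀ n, Tbar n < t (2 * n + 1) - t (2 * n))
    (d : ℕ → ℝ → ℝ)
    (hd : ∀ n T, Tbar n < T → T ≤ t (2 * n + 1) - t (2 * n) → 0 < d n T)
    (h_obs : ∀ n T, Tbar n < T → T ≤ t (2 * n + 1) - t (2 * n) →
      ∀ (w : ℝ → EnergySpace S) (w' : ℝ → H) (z : ℝ → U₁),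
        IsDampedSolution B₁ (t (2 * n)) (t (2 * n + 1)) w w' z →
        standardEnergy (w (t (2 * n) + T)) (w' (t (2 * n) + T)) ≤
          d n T * ∫ s in t (2 * n)..(t (2 * n) + T), ‖z s‖ ^ 2)
    -- the two series conditions, `d n` being taken at the time `T_{2n}`
    (h_sum : Summable fun n => M (2 * n + 1) * (t (2 * n + 2) - t (2 * n + 1)))
    (h_log : Tendsto (fun N => ∑ n ∈ Finset.range N,
      Real.log (d n (t (2 * n + 1) - t (2 * n)) / (d n (t (2 * n + 1) - t (2 * n)) + 1)))
      atTop atBot)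
    -- an arbitrary solution
    (u : ℝ → EnergySpace S) (u' : ℝ → H) (z : ℝ → U₁)
    (hu : IsDelaySolution B₁ B₂ τ t u u' z) :
    Tendsto (fun s => standardEnergy (u s) (u' s)) atTop (𝓝 0) := by
  refine theorem4p3_general hτ ht0 ht hT_even hT_odd hB₂_zero hB₁_zero (fun n => ?_)
    (fun n => (hB₁_adm n).boundedDamping (hm n) fun s hs => h_i n s (Ioo_subset_Ico_self hs))
    (fun n s hs => norm_sq_le_of_norm_adjoint_sq_le jW (hM n).le (h_ii n s hs))
    (fun n => hd n _ (hTbar n) le_rfl)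
    (fun n => by simpa only [add_sub_cancel] using h_obs n _ (hTbar n) le_rfl)
    (by simpa only [mul_right_comm] using h_sum.mul_right (‖jW‖ ^ 2)) h_log hu
  obtain ⟨F, hF, hBF⟩ := hB₂_cont n
  exact aestronglyMeasurable_of_eq_continuousOn hF fun s hs => hBF s (Ioo_subset_Ico_self hs)
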